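/- A finite quantum set $\mathbb X$ is a finite-dimensional C*-algebra $C(\mathbb X)$ with its tracial $1$-form, i.e. the faithful positive tracial functional $\psi$ such that $mm^*=\mathrm{id}$, where $m$ is the multiplication map and adjoints are taken with respect to $\langle x,y\rangle=\psi(x^*y)$; write $\ell^2(\mathbb X)$ for the resulting Hilbert space, $\eta=1_{C(\mathbb X)}$, $A\bullet B=m(A\otimes B)m^*$ and $\bar A f=(A(f^*))^*$. A directed quantum graph on $\mathbb X$ is an operator $A$ on $\ell^2(\mathbb X)$ with $A\bullet A=A=\bar A$; it has no loops if $A\bullet I=0$, and it is $d$-regular ($d\in\mathbb C$) if $A\eta=A^*\eta=d\eta$. For a family $(A_s)_s$ of such operators, $\mathcal O(\bigcap_s\mathrm{Qut}(\mathbb X,A_s))$ is the universal unital *-algebra generated by the entries of a matrix $u$ (in an orthonormal basis of $\ell^2(\mathbb X)$) with the relations: $u$ is unitary, $m(u\otimes u)=um$, $u\eta=\eta$, and $uA_s=A_su$ for all $s$, with $\Delta(u_{ij})=\sum_k u_{ik}\otimes u_{kj}$; for one graph this is $\mathcal O(\mathrm{Qut}(\mathbb X,A))$, and for the empty family it is $\mathcal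 O(\mathrm{Qut}(\mathbb X))$. **Theorem.** Let $\mathbb X$ be a finite quantum set, $n\in\mathbb N$, and let $\mathcal G_i=(\mathbb X,A_i)$, $1\le i\le n$, be directed regular quantum graphs without loops on $\mathbb X$. Then there is a directed quantum graph without loops $\mathcal G=(\mathbb X',A')$ such that $$\mathrm{Qut}(\mathcal G)=\bigcap_{i=1}^n\mathrm{Qut}(\mathcal G_i).$$ More precisely, one can take $C(\mathbb X')=C(\mathbb X)\otimes\mathbb C^{n+1}$ and $$A'=I\otimes B+\sum_{i=1}^n A_i\otimes P_i,$$ where $B$ is the adjacency matrix of a suitable classical directed graph without loops on the vertex set $\{0,1,\dots,n\}$ and $P_i$ is the projection onto the $i$-th basis vector of $\mathbb C^{n+1}$ $(0\le i\le n)$. The equality means that there is an isomorphism of Hopf *-algebras $\mathcal O(\mathrm{Qut}(\mathcal G))\cong\mathcal O(\bigcap_i\mathrm{Qut}(\mathcal G_i))$ which identifies the canonical action of $\mathrm{Qut}(\mathcal G)$ on $\mathbb X'$ with the canonical action of $\bigcap_i\mathrm{Qut}(\mathcal G_i)$ on $\mathbb X$ tensored with the trivial action on $\mathbb C^{n+1}$.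 Moreover, if $\mathcal G_i$ is $d_i$-regular with $d_i \in \mathbb R$, $d_1\le\dots\le d_n$, and no $A_i$ is zero, then $B$ can be taken to be the adjacency matrix of the simple graph $\mathcal H$ on $\{0,1,\dots,n\}$ in which $0$ is adjacent exactly to the vertices $i>\lfloor n/2\rfloor$, and distinct $i,j\ge1$ are adjacent if and only if $i+j>n$. -/

import Mathlib

open scoped TensorProduct ComplexOrder

noncomputable section

/-! ### Finite quantum sets -/

/-- A positive faithful tracial functional `ψ` on a C*-algebra. -/
structure FaithfulTrace (C : Type*) [CStarAlgebra C] where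
  ψ : C →ₗ[ℂ] ℂ
  nonneg : ∀ x, 0 ≤ ψ (star x * x)
  faithful : ∀ x, ψ (star x * x) = 0 → x = 0
  tracial : ∀ x y, ψ (x * y) = ψ (y * x)

namespace FaithfulTrace

variable {C : Type*} [CStarAlgebra C] (τ : FaithfulTrace C)

theorem map_star (x : C) : τ.ψ (star x) = star (τ.ψ x) := by
  have h1 := (Complex.nonneg_iff.1 (τ.nonneg (x + 1))).2
  have h2 := (Complex.nonneg_iff.1 (τ.nonneg (x + Complex.I • 1))).2
  have h3 := (Complex.nonneg_iff.1 (τ.nonneg x)).2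
  have h4 := (Complex.nonneg_iff.1 (τ.nonneg 1)).2
  simp [add_mul, mul_add] at h1 h2 h3 h4
  apply Complex.ext <;> simp <;> linarith

/-- The vector space underlying the Hilbert space `ℓ²(𝕏)`: the *-algebra `C` itself. It is a
separate type because its norm is the Hilbert space norm, not the C*-norm. -/
def L2 (_τ : FaithfulTrace C) : Type _ := C

instance : Ring τ.L2 := inferInstanceAs (Ring C)
instance : StarRing τ.L2 := inferInstanceAs (StarRing C)
instance : Algebra ℂ τ.L2 := inferInstanceAs (Algebra ℂ C)
instance : StarModule ℂ τ.L2 := inferInstanceAs (StarModule ℂ C)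
instance [h : FiniteDimensional ℂ C] : FiniteDimensional ℂ τ.L2 := h

/-- The identity map `C(𝕏) → ℓ²(𝕏)`. -/
def toL2 : C ≃⋆ₐ[ℂ] τ.L2 := StarAlgEquiv.refl (R := ℂ) (A := C)

/-- The functional `ψ`, viewed on `ℓ²(𝕏)`. -/
def functional : τ.L2 →ₗ[ℂ] ℂ := τ.ψ

theorem functional_star (x : τ.L2) : τ.functional (star x) = star (τ.functional x) :=
  τ.map_star x

/-- The inner product `⟨x, y⟩ = ψ(x* y)`. -/
@[reducible]
def core : InnerProductSpace.Core ℂ τ.L2 where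
  inner x y := τ.functional (star x * y)
  conj_inner_symm x y := by
    rw [starRingEnd_apply, ← τ.functional_star]; simp
  re_inner_nonneg x := (Complex.nonneg_iff.1 (τ.nonneg x)).1
  add_left x y z := by simp [add_mul]
  smul_left x y r := by simp
  definite x h := τ.faithful x h

instance : NormedAddCommGroup τ.L2 := τ.core.toNormedAddCommGroup
instance : InnerProductSpace ℂ τ.L2 := .ofCore τ.core.toCore

theorem inner_def (x y : τ.L2) : inner ℂ x y = τ.functional (star x * y) := rfl

end FaithfulTrace

/-- A finite quantum set `𝕏`: a finite-dimensional C*-algebra `C = C(𝕏)` with its tracial 1-form,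
i.e. the positive faithful tracial functional such that `m m* = id`, where `m` is the multiplication
and `m*` is its Hilbert space adjoint. -/
structure FiniteQuantumSet (C : Type*) [CStarAlgebra C] [FiniteDimensional ℂ C]
    extends FaithfulTrace C where
  one_form : LinearMap.mul' ℂ toFaithfulTrace.L2 ∘ₗ
    LinearMap.adjoint (LinearMap.mul' ℂ toFaithfulTrace.L2) = LinearMap.id

namespace FiniteQuantumSet

variable {C : Type*} [CStarAlgebra C] [FiniteDimensional ℂ C] (X : FiniteQuantumSet C)

/-- The Hilbert space `ℓ²(𝕏)`. -/
abbrev L2 : Type _ := X.toFaithfulTrace.L2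

/-- The multiplication map `m : ℓ²(𝕏) ⊗ ℓ²(𝕏) → ℓ²(𝕏)`. -/
def mulMap : X.L2 ⊗[ℂ] X.L2 →ₗ[ℂ] X.L2 := LinearMap.mul' ℂ X.L2

/-! ### Quantum graphs -/

/-- The Schur product `A • B = m (A ⊗ B) m*`. -/
def schur (A B : X.L2 →ₗ[ℂ] X.L2) : X.L2 →ₗ[ℂ] X.L2 :=
  X.mulMap ∘ₗ TensorProduct.map A B ∘ₗ LinearMap.adjoint X.mulMap

/-- The complex conjugate `Ā f = (A f*)*`. -/
def conj (A : X.L2 →ₗ[ℂ] X.L2) : X.L2 →ₗ[ℂ] X.L2 where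
  toFun f := star (A (star f))
  map_add' f g := by simp
  map_smul' c f := by simp

/-- `A` is the quantum adjacency matrix of a directed quantum graph on `𝕏`. -/
structure IsQuantumGraph (A : X.L2 →ₗ[ℂ] X.L2) : Prop where
  schur_idem : X.schur A A = A
  real : X.conj A = A

/-- The quantum graph has no loops. -/
def NoLoops (A : X.L2 →ₗ[ℂ] X.L2) : Prop := X.schur A LinearMap.id = 0

/-- The quantum graph is `d`-regular: `A η = A* η = d η`, where `η = 1`. -/
structure IsRegularOfDegree (A : X.L2 →ₗ[ℂ] X.L2) (d : ℂ) : Prop where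
  apply_one : A 1 = d • 1
  adjoint_one : LinearMap.adjoint A 1 = d • 1

/-- The quantum graph is regular. -/
def IsRegular (A : X.L2 →ₗ[ℂ] X.L2) : Prop := ∃ d : ℂ, X.IsRegularOfDegree A d

end FiniteQuantumSet

/-! ### The quantum set `𝕏 ⊗ ℂᵐ` -/

/-- The trace `ψ(f) = ∑ₐ ψ(fₐ)` on `C ⊗ ℂᵐ = Cᵐ`. -/
def FaithfulTrace.amplify {C : Type*} [CStarAlgebra C] (τ : FaithfulTrace C) (m : ℕ) :
    FaithfulTrace (Fin m → C) where
  ψ := ∑ a, τ.ψ ∘ₗ LinearMap.proj a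
  nonneg f := by
    simp only [LinearMap.sum_apply]
    exact Finset.sum_nonneg fun a _ => τ.nonneg (f a)
  faithful f h := by
    simp only [LinearMap.sum_apply] at h
    change ∑ a, τ.ψ (star (f a) * f a) = 0 at h
    rw [Finset.sum_eq_zero_iff_of_nonneg fun a _ => τ.nonneg (f a)] at h
    exact funext fun a => τ.faithful _ (h a (Finset.mem_univ a))
  tracial f g := by
    simp only [LinearMap.sum_apply]
    exact Finset.sum_congr rfl fun a _ => τ.tracial (f a) (g a)

namespace FaithfulTrace

variable {C : Type*} [CStarAlgebra C] (τ : FaithfulTrace C) {m : ℕ}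

/-- The `a`-th coordinate map `C ⊗ ℂᵐ = Cᵐ → C`. -/
def coord (a : Fin m) : (τ.amplify m).L2 →ₗ[ℂ] τ.L2 where
  toFun f := τ.toL2 ((τ.amplify m).toL2.symm f a)
  map_add' _ _ := rfl
  map_smul' _ _ := rfl

/-- The `a`-th inclusion `x ↦ x ⊗ eₐ`. -/
def incl (a : Fin m) : τ.L2 →ₗ[ℂ] (τ.amplify m).L2 where
  toFun x := (τ.amplify m).toL2 (Pi.single a (τ.toL2.symm x))
  map_add' x y := by
    rw [map_add, Pi.single_add, map_add]
  map_smul' c x := by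
    rw [map_smul, Pi.single_smul, map_smul]; rfl

theorem ext_coord {f g : (τ.amplify m).L2} (h : ∀ a, τ.coord a f = τ.coord a g) : f = g :=
  funext h

theorem coord_incl (a b : Fin m) (x : τ.L2) :
    τ.coord a (τ.incl b x) = if a = b then x else 0 := by
  split_ifs with h
  · subst h
    exact Pi.single_eq_same (M := fun _ => C) a (τ.toL2.symm x)
  · exact Pi.single_eq_of_ne (M := fun _ => C) h (τ.toL2.symm x)

theorem coord_mul (a : Fin m) (f g : (τ.amplify m).L2) :
    τ.coord a (f * g) = τ.coord a f * τ.coord a g := rfl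

theorem inner_amplify (f g : (τ.amplify m).L2) :
    inner ℂ f g = ∑ a, inner ℂ (τ.coord a f) (τ.coord a g) :=
  LinearMap.sum_apply (M := Fin m → C) (M₂ := ℂ) Finset.univ
    (fun a => τ.ψ ∘ₗ LinearMap.proj a) (star f * g : Fin m → C)

theorem sum_incl_coord (f : (τ.amplify m).L2) : ∑ a, τ.incl a (τ.coord a f) = f := by
  refine τ.ext_coord fun b => ?_
  rw [map_sum, Finset.sum_eq_single b]
  · rw [coord_incl, if_pos rfl]
  · intro a _ h; rw [coord_incl, if_neg h.symm]
  · simp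

theorem incl_mul (a : Fin m) (x y : τ.L2) : τ.incl a (x * y) = τ.incl a x * τ.incl a y := by
  refine τ.ext_coord fun b => ?_
  rw [coord_mul, coord_incl, coord_incl, coord_incl]
  split_ifs <;> simp

theorem inner_incl_left (a : Fin m) (x : τ.L2) (f : (τ.amplify m).L2) :
    inner ℂ (τ.incl a x) f = inner ℂ x (τ.coord a f) := by
  rw [inner_amplify, Finset.sum_eq_single a]
  · rw [coord_incl, if_pos rfl]
  · intro b _ h; rw [coord_incl, if_neg h, inner_zero_left]
  · simp

end FaithfulTrace

namespace FiniteQuantumSet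

variable {C : Type*} [CStarAlgebra C] [FiniteDimensional ℂ C] (X : FiniteQuantumSet C)

/-- The finite quantum set `𝕏 ⊗ ℂᵐ`, i.e. the product of `𝕏` with a classical set of `m` points.
Its algebra `C(𝕏) ⊗ ℂᵐ` is realised as `Fin m → C(𝕏)`. -/
def amplify (m : ℕ) : FiniteQuantumSet (Fin m → C) where
  toFaithfulTrace := X.toFaithfulTrace.amplify m
  one_form := by
    set τ := X.toFaithfulTrace with hτ
    have key : LinearMap.adjoint (LinearMap.mul' ℂ (τ.amplify m).L2) =
        ∑ a, TensorProduct.map (τ.incl a) (τ.incl a) ∘ₗ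
          LinearMap.adjoint (LinearMap.mul' ℂ τ.L2) ∘ₗ τ.coord a := by
      symm
      rw [LinearMap.eq_adjoint_iff]
      intro f t
      induction t using TensorProduct.induction_on with
      | zero => simp only [map_zero, inner_zero_right]
      | add s t hs ht => rw [inner_add_right, hs, ht, map_add, inner_add_right]
      | tmul g h =>
        rw [LinearMap.sum_apply, sum_inner, LinearMap.mul'_apply, τ.inner_amplify]
        refine Finset.sum_congr rfl fun a _ => ?_
        rw [τ.coord_mul, ← LinearMap.mul'_apply (R := ℂ), ← LinearMap.adjoint_inner_left]
        rw [LinearMap.comp_apply, LinearMap.comp_apply]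
        generalize LinearMap.adjoint (LinearMap.mul' ℂ τ.L2) (τ.coord a f) = s
        induction s using TensorProduct.induction_on with
        | zero => simp only [map_zero, inner_zero_left]
        | add s t hs ht => rw [inner_add_left, map_add, inner_add_left, hs, ht]
        | tmul x y =>
          rw [TensorProduct.map_tmul, TensorProduct.inner_tmul, TensorProduct.inner_tmul,
            τ.inner_incl_left, τ.inner_incl_left]
    refine LinearMap.ext fun f => ?_
    rw [key, LinearMap.comp_apply, LinearMap.sum_apply, map_sum, LinearMap.id_apply]
    conv_rhs => rw [← τ.sum_incl_coord f]
    refine Finset.sum_congr rfl fun a _ => ?_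
    have h1 : ∀ s : τ.L2 ⊗[ℂ] τ.L2, LinearMap.mul' ℂ (τ.amplify m).L2
        (TensorProduct.map (τ.incl a) (τ.incl a) s) = τ.incl a (LinearMap.mul' ℂ τ.L2 s) := by
      intro s
      induction s using TensorProduct.induction_on with
      | zero => simp only [map_zero]
      | add s t hs ht => rw [map_add, map_add, map_add, map_add, hs, ht]
      | tmul x y =>
        rw [TensorProduct.map_tmul, LinearMap.mul'_apply, LinearMap.mul'_apply, τ.incl_mul]
    rw [LinearMap.comp_apply, LinearMap.comp_apply, h1]
    exact congrArg _ (LinearMap.congr_fun X.one_form (τ.coord a f))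

/-- The `a`-th coordinate map `ℓ²(𝕏) ⊗ ℂᵐ → ℓ²(𝕏)`. -/
def coord {m : ℕ} (a : Fin m) : (X.amplify m).L2 →ₗ[ℂ] X.L2 := X.toFaithfulTrace.coord a

/-- The `a`-th inclusion `ℓ²(𝕏) → ℓ²(𝕏) ⊗ ℂᵐ`, `x ↦ x ⊗ eₐ`. -/
def incl {m : ℕ} (a : Fin m) : X.L2 →ₗ[ℂ] (X.amplify m).L2 := X.toFaithfulTrace.incl a

theorem coord_incl {m : ℕ} (a b : Fin m) (x : X.L2) :
    X.coord a (X.incl b x) = if a = b then x else 0 := X.toFaithfulTrace.coord_incl a b x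

/-- The operator `T ⊗ D` on `ℓ²(𝕏) ⊗ ℂᵐ`. -/
def tensorOp {m : ℕ} (T : X.L2 →ₗ[ℂ] X.L2) (D : Matrix (Fin m) (Fin m) ℂ) :
    (X.amplify m).L2 →ₗ[ℂ] (X.amplify m).L2 :=
  ∑ i, ∑ j, D i j • (X.incl i ∘ₗ T ∘ₗ X.coord j)

theorem coord_tensorOp {m : ℕ} (T : X.L2 →ₗ[ℂ] X.L2) (D : Matrix (Fin m) (Fin m) ℂ)
    (f : (X.amplify m).L2) (a : Fin m) :
    X.coord a (X.tensorOp T D f) = ∑ j, D a j • T (X.coord j f) := by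
  simp only [tensorOp, LinearMap.sum_apply, map_sum, LinearMap.smul_apply, LinearMap.comp_apply,
    map_smul, coord_incl]
  rw [Finset.sum_eq_single a] <;> simp +contextual [eq_comm]

/-- The operator `A' = I ⊗ B + ∑ᵢ Aᵢ ⊗ Pᵢ` on `ℓ²(𝕏) ⊗ ℂⁿ⁺¹`. The vertices of the classical graph
with adjacency matrix `B` are `0, 1, …, n`; the operator `Aᵢ`, `1 ≤ i ≤ n`, sits at the vertex `i`
(in the code `i : Fin n` starts at zero, and `i.succ` is the vertex), and `Pᵢ` is the projection
onto the `i`-th basis vector. -/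
def combined {n : ℕ} (A : Fin n → X.L2 →ₗ[ℂ] X.L2)
    (B : Matrix (Fin (n + 1)) (Fin (n + 1)) ℂ) :
    (X.amplify (n + 1)).L2 →ₗ[ℂ] (X.amplify (n + 1)).L2 :=
  X.tensorOp LinearMap.id B + ∑ i, X.tensorOp (A i) (Matrix.single i.succ i.succ 1)

end FiniteQuantumSet

/-! ### Universal *-algebras given by generators and relations -/

/-- The free unital *-algebra over `ℂ` on a set `G`: the free algebra on symbols `g` and `g*`. -/
def FreeStarAlg (G : Type*) : Type _ := FreeAlgebra ℂ (G ⊕ G)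

namespace FreeStarAlg

variable {G : Type*}

instance : Ring (FreeStarAlg G) := inferInstanceAs (Ring (FreeAlgebra ℂ (G ⊕ G)))
instance : Algebra ℂ (FreeStarAlg G) := inferInstanceAs (Algebra ℂ (FreeAlgebra ℂ (G ⊕ G)))

/-- The symbols `g` (as `Sum.inl g`) and `g*` (as `Sum.inr g`). -/
def symbol : G ⊕ G → FreeStarAlg G := FreeAlgebra.ι ℂ

/-- The generator `g`. -/
def gen (g : G) : FreeStarAlg G := symbol (Sum.inl g)

/-- The universal property of the underlying algebra. -/
def liftAlg {D : Type*} [Ring D] [Algebra ℂ D] (f : G ⊕ G → D) : FreeStarAlg G →ₐ[ℂ] D :=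
  FreeAlgebra.lift ℂ f

theorem liftAlg_symbol {D : Type*} [Ring D] [Algebra ℂ D] (f : G ⊕ G → D) (g : G ⊕ G) :
    liftAlg f (symbol g) = f g := FreeAlgebra.lift_ι_apply f g

theorem algHom_ext {D : Type*} [Ring D] [Algebra ℂ D] {f g : FreeStarAlg G →ₐ[ℂ] D}
    (h : ∀ x, f (symbol x) = g (symbol x)) : f = g :=
  FreeAlgebra.hom_ext (funext h)

theorem induction {p : FreeStarAlg G → Prop} (h1 : ∀ r : ℂ, p (algebraMap ℂ _ r))
    (h2 : ∀ x, p (symbol x)) (h3 : ∀ a b, p a → p b → p (a * b))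
    (h4 : ∀ a b, p a → p b → p (a + b)) (a : FreeStarAlg G) : p a :=
  FreeAlgebra.induction ℂ (G ⊕ G) (motive := p) h1 h2 h3 h4 a

/-- The conjugate-linear antiautomorphism exchanging `g` and `g*`. -/
def starHom : FreeStarAlg G →+* (FreeStarAlg G)ᵐᵒᵖ :=
  letI : Algebra ℂ (FreeStarAlg G)ᵐᵒᵖ := RingHom.toAlgebra'
    ((algebraMap ℂ (FreeStarAlg G)ᵐᵒᵖ).comp (starRingEnd ℂ))
    (fun c x => Algebra.commutes (starRingEnd ℂ c) x)
  (liftAlg fun g => MulOpposite.op (symbol g.swap)).toRingHom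

theorem starHom_symbol (g : G ⊕ G) :
    starHom (symbol g) = MulOpposite.op (symbol g.swap) := by
  let : Algebra ℂ (FreeStarAlg G)ᵐᵒᵖ := RingHom.toAlgebra'
    ((algebraMap ℂ (FreeStarAlg G)ᵐᵒᵖ).comp (starRingEnd ℂ))
    (fun c x => Algebra.commutes (starRingEnd ℂ c) x)
  exact liftAlg_symbol (D := (FreeStarAlg G)ᵐᵒᵖ) (fun g => MulOpposite.op (symbol g.swap)) g

theorem starHom_algebraMap (r : ℂ) : starHom (algebraMap ℂ (FreeStarAlg G) r) =
    MulOpposite.op (algebraMap ℂ (FreeStarAlg G) (star r)) := by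
  let : Algebra ℂ (FreeStarAlg G)ᵐᵒᵖ := RingHom.toAlgebra'
    ((algebraMap ℂ (FreeStarAlg G)ᵐᵒᵖ).comp (starRingEnd ℂ))
    (fun c x => Algebra.commutes (starRingEnd ℂ c) x)
  exact (liftAlg (D := (FreeStarAlg G)ᵐᵒᵖ)
    (fun g => MulOpposite.op (symbol g.swap))).commutes r

instance : StarRing (FreeStarAlg G) where
  star a := (starHom a).unop
  star_involutive a := by
    induction a using induction with
    | h1 r => simp [starHom_algebraMap]
    | h2 x => simp [starHom_symbol]
    | h3 a b ha hb => simp only [map_mul, MulOpposite.unop_mul, ha, hb]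
    | h4 a b ha hb => simp only [map_add, MulOpposite.unop_add, ha, hb]
  star_mul a b := by simp
  star_add a b := by simp

theorem star_symbol (g : G ⊕ G) : star (symbol g : FreeStarAlg G) = symbol g.swap :=
  congrArg MulOpposite.unop (starHom_symbol g)

theorem star_algebraMap (r : ℂ) : star (algebraMap ℂ (FreeStarAlg G) r) =
    algebraMap ℂ (FreeStarAlg G) (star r) :=
  congrArg MulOpposite.unop (starHom_algebraMap r)

instance : StarModule ℂ (FreeStarAlg G) where
  star_smul r a := by
    rw [Algebra.smul_def, star_mul, star_algebraMap, ← Algebra.commutes, ← Algebra.smul_def]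

section lift

variable {D : Type*} [Ring D] [StarRing D] [Algebra ℂ D]

/-- The *-homomorphism determined by the images of the generators. -/
def lift (f : G → D) : FreeStarAlg G →ₐ[ℂ] D := liftAlg (Sum.elim f fun g => star (f g))

theorem lift_gen (f : G → D) (g : G) : lift f (gen g) = f g := liftAlg_symbol _ _

theorem lift_star [StarModule ℂ D] (f : G → D) (a : FreeStarAlg G) : lift f (star a) = star (lift f a) := by
  induction a using induction with
  | h1 r =>
    rw [star_algebraMap, AlgHom.commutes, AlgHom.commutes, algebraMap_star_comm]
  | h2 x =>
    rw [star_symbol]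
    unfold lift
    rw [liftAlg_symbol, liftAlg_symbol]
    cases x <;> simp
  | h3 a b ha hb => rw [star_mul, map_mul, map_mul, star_mul, ha, hb]
  | h4 a b ha hb => rw [star_add, map_add, map_add, star_add, ha, hb]

end lift

end FreeStarAlg

/-- The relations `R` together with their adjoints. -/
def StarClosure {G : Type*} (R : FreeStarAlg G → FreeStarAlg G → Prop)
    (a b : FreeStarAlg G) : Prop := R a b ∨ R (star a) (star b)

theorem StarClosure.star {G : Type*} {R : FreeStarAlg G → FreeStarAlg G → Prop}
    (a b : FreeStarAlg G) (h : StarClosure R a b) : StarClosure R (star a) (star b) := by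
  rcases h with h | h
  · right; rwa [star_star, star_star]
  · left; exact h

/-- The universal unital *-algebra over `ℂ` with generators `G` and relations `a = b` for all
`a, b` with `R a b`. -/
def UnivStarAlg {G : Type*} (R : FreeStarAlg G → FreeStarAlg G → Prop) : Type _ :=
  RingQuot (StarClosure R)

namespace UnivStarAlg

variable {G : Type*} {R : FreeStarAlg G → FreeStarAlg G → Prop}

instance : Ring (UnivStarAlg R) := inferInstanceAs (Ring (RingQuot (StarClosure R)))
instance : Algebra ℂ (UnivStarAlg R) := inferInstanceAs (Algebra ℂ (RingQuot (StarClosure R)))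
instance : StarRing (UnivStarAlg R) := RingQuot.starRing (StarClosure R) StarClosure.star

variable (R) in
/-- The quotient map. -/
def mk : FreeStarAlg G →ₐ[ℂ] UnivStarAlg R := RingQuot.mkAlgHom ℂ (StarClosure R)

theorem mk_surjective : Function.Surjective (mk R) := RingQuot.mkAlgHom_surjective ℂ _

theorem mk_star (a : FreeStarAlg G) : mk R (star a) = star (mk R a) := by
  symm
  change (RingQuot.starRing (StarClosure R) StarClosure.star).star
    (RingQuot.mkAlgHom ℂ (StarClosure R) a) = RingQuot.mkAlgHom ℂ (StarClosure R) (star a)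
  simp only [RingQuot.mkAlgHom_def, RingQuot.mkRingHom_def]
  rfl

theorem mk_rel {a b : FreeStarAlg G} (h : R a b) : mk R a = mk R b :=
  RingQuot.mkAlgHom_rel ℂ (Or.inl h)

instance : StarModule ℂ (UnivStarAlg R) where
  star_smul r x := by
    obtain ⟨a, rfl⟩ := mk_surjective x
    rw [← map_smul, ← mk_star, star_smul, map_smul, mk_star]

variable (R) in
/-- The image of a generator. -/
def gen (g : G) : UnivStarAlg R := mk R (FreeStarAlg.gen g)

theorem algHom_ext {D : Type*} [Ring D] [Algebra ℂ D] {f g : UnivStarAlg R →ₐ[ℂ] D}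
    (h : ∀ x, f (gen R x) = g (gen R x)) (h' : ∀ x, f (star (gen R x)) = g (star (gen R x))) :
    f = g := by
  have : f.comp (mk R) = g.comp (mk R) := by
    refine FreeStarAlg.algHom_ext fun x => ?_
    rcases x with x | x
    · exact h x
    · have h2 := h' x
      rw [gen, ← mk_star, FreeStarAlg.gen, FreeStarAlg.star_symbol] at h2
      exact h2
  refine AlgHom.ext fun x => ?_
  obtain ⟨a, rfl⟩ := mk_surjective x
  exact AlgHom.congr_fun this a

section lift

variable {D : Type*} [Ring D] [StarRing D] [Algebra ℂ D] [StarModule ℂ D]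

/-- The universal property: a *-homomorphism is determined by images of the generators that
satisfy the relations. -/
def lift (f : G → D)
    (hf : ∀ a b, R a b → FreeStarAlg.lift f a = FreeStarAlg.lift f b) : UnivStarAlg R →ₐ[ℂ] D :=
  RingQuot.liftAlgHom ℂ ⟨FreeStarAlg.lift f, by
    rintro a b (h | h)
    · exact hf a b h
    · have := hf _ _ h
      rw [FreeStarAlg.lift_star, FreeStarAlg.lift_star] at this
      exact star_injective this⟩

theorem lift_mk (f : G → D)
    (hf : ∀ a b, R a b → FreeStarAlg.lift f a = FreeStarAlg.lift f b) (a : FreeStarAlg G) :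
    lift f hf (mk R a) = FreeStarAlg.lift f a :=
  RingQuot.liftAlgHom_mkAlgHom_apply ℂ _ _ a

theorem lift_gen (f : G → D)
    (hf : ∀ a b, R a b → FreeStarAlg.lift f a = FreeStarAlg.lift f b) (g : G) :
    lift f hf (gen R g) = f g := by
  rw [gen, lift_mk, FreeStarAlg.lift_gen]

theorem lift_star (f : G → D)
    (hf : ∀ a b, R a b → FreeStarAlg.lift f a = FreeStarAlg.lift f b) (x : UnivStarAlg R) :
    lift f hf (star x) = star (lift f hf x) := by
  obtain ⟨a, rfl⟩ := mk_surjective x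
  rw [← mk_star, lift_mk, lift_mk, FreeStarAlg.lift_star]

end lift

end UnivStarAlg

/-! ### Quantum automorphism groups -/

namespace FiniteQuantumSet

variable {C : Type*} [CStarAlgebra C] [FiniteDimensional ℂ C] {X : FiniteQuantumSet C}
  {ι κ : Type*} [Fintype ι] [DecidableEq ι]

/-- The defining relations, for a matrix `u` with entries in a *-algebra `D` (with respect to an
orthonormal basis `b` of `ℓ²(𝕏)`) and a family `A` of operators on `ℓ²(𝕏)`, written entrywise:
`u` is unitary, `m (u ⊗ u) = u m`, `u η = η`, and `u Aₛ = Aₛ u` for all `s`. -/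
inductive QutRel (b : OrthonormalBasis ι ℂ X.L2) (A : κ → X.L2 →ₗ[ℂ] X.L2)
    {D : Type*} [Ring D] [StarRing D] [Algebra ℂ D] (u : ι → ι → D) : D → D → Prop
  | star_mul_self (i j : ι) :
      QutRel b A u (∑ k, star (u k i) * u k j) (if i = j then 1 else 0)
  | mul_star_self (i j : ι) :
      QutRel b A u (∑ k, u i k * star (u j k)) (if i = j then 1 else 0)
  | mult (k i j : ι) :
      QutRel b A u (∑ p, ∑ q, inner ℂ (b k) (b p * b q) • (u p i * u q j))
        (∑ l, inner ℂ (b l) (b i * b j) • u k l)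
  | unit (i : ι) :
      QutRel b A u (∑ j, inner ℂ (b j) (1 : X.L2) • u i j) (inner ℂ (b i) (1 : X.L2) • 1)
  | comm (s : κ) (i j : ι) :
      QutRel b A u (∑ k, inner ℂ (b k) (A s (b j)) • u i k)
        (∑ k, inner ℂ (b i) (A s (b k)) • u k j)

/-- The matrix `u` satisfies the defining relations. -/
def IsQutMatrix (b : OrthonormalBasis ι ℂ X.L2) (A : κ → X.L2 →ₗ[ℂ] X.L2)
    {D : Type*} [Ring D] [StarRing D] [Algebra ℂ D] (u : ι → ι → D) : Prop :=
  ∀ x y, QutRel b A u x y → x = y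

/-- The algebra `𝒪(⋂ₛ Qut(𝕏, Aₛ))` of the intersection of the quantum automorphism groups of the
quantum graphs `(𝕏, Aₛ)`: the universal *-algebra generated by the entries `u i j` of a matrix
subject to the defining relations of all `𝒪(Qut(𝕏, Aₛ))`. (For an empty family it is
`𝒪(Qut(𝕏))`.) -/
def QutInterAlg (b : OrthonormalBasis ι ℂ X.L2) (A : κ → X.L2 →ₗ[ℂ] X.L2) : Type _ :=
  UnivStarAlg (G := ι × ι) (QutRel b A fun i j => FreeStarAlg.gen (i, j))

/-- The algebra `𝒪(Qut(𝕏, A))` of the quantum automorphism group of a quantum graph. -/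
abbrev QutAlg (b : OrthonormalBasis ι ℂ X.L2) (A : X.L2 →ₗ[ℂ] X.L2) : Type _ :=
  QutInterAlg b fun _ : Unit => A

namespace QutInterAlg

variable (b : OrthonormalBasis ι ℂ X.L2) (A : κ → X.L2 →ₗ[ℂ] X.L2)

instance : Ring (QutInterAlg b A) := inferInstanceAs (Ring (UnivStarAlg _))
instance : Algebra ℂ (QutInterAlg b A) := inferInstanceAs (Algebra ℂ (UnivStarAlg _))
instance : StarRing (QutInterAlg b A) := inferInstanceAs (StarRing (UnivStarAlg _))
instance : StarModule ℂ (QutInterAlg b A) := inferInstanceAs (StarModule ℂ (UnivStarAlg _))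

/-- The fundamental representation. -/
def u (i j : ι) : QutInterAlg b A := UnivStarAlg.gen (G := ι × ι) _ (i, j)

variable {b A}

theorem algHom_ext {D : Type*} [Ring D] [Algebra ℂ D] {f g : QutInterAlg b A →ₐ[ℂ] D}
    (h : ∀ i j, f (u b A i j) = g (u b A i j))
    (h' : ∀ i j, f (star (u b A i j)) = g (star (u b A i j))) : f = g :=
  UnivStarAlg.algHom_ext (G := ι × ι) (fun x => h x.1 x.2) (fun x => h' x.1 x.2)

section maps

variable {D E : Type*} [Ring D] [StarRing D] [Algebra ℂ D] [Ring E] [StarRing E] [Algebra ℂ E]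

theorem rel_map (φ : D →ₐ[ℂ] E) (hφ : ∀ x, φ (star x) = star (φ x)) {v : ι → ι → D} {x y : D}
    (h : QutRel b A v x y) : QutRel b A (fun i j => φ (v i j)) (φ x) (φ y) := by
  cases h with
  | star_mul_self i j =>
    simpa [map_sum, hφ, apply_ite φ] using
      QutRel.star_mul_self (b := b) (A := A) (u := fun i j => φ (v i j)) i j
  | mul_star_self i j =>
    simpa [map_sum, hφ, apply_ite φ] using
      QutRel.mul_star_self (b := b) (A := A) (u := fun i j => φ (v i j)) i j
  | mult k i j =>
    simpa [map_sum] using QutRel.mult (b := b) (A := A) (u := fun i j => φ (v i j)) k i j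
  | unit i =>
    simpa [map_sum] using QutRel.unit (b := b) (A := A) (u := fun i j => φ (v i j)) i
  | comm s i j =>
    simpa [map_sum] using QutRel.comm (b := b) (A := A) (u := fun i j => φ (v i j)) s i j

variable [StarModule ℂ D]

/-- The universal property. -/
def lift (v : ι → ι → D) (hv : IsQutMatrix b A v) : QutInterAlg b A →ₐ[ℂ] D :=
  UnivStarAlg.lift (G := ι × ι) (fun x => v x.1 x.2) fun x y h => by
    have := rel_map (FreeStarAlg.lift fun x : ι × ι => v x.1 x.2) (FreeStarAlg.lift_star _) h
    simp only [FreeStarAlg.lift_gen] at this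
    exact hv _ _ this

theorem lift_u (v : ι → ι → D) (hv : IsQutMatrix b A v) (i j : ι) :
    lift v hv (u b A i j) = v i j := UnivStarAlg.lift_gen _ _ _

theorem lift_star (v : ι → ι → D) (hv : IsQutMatrix b A v) (x : QutInterAlg b A) :
    lift v hv (star x) = star (lift v hv x) := UnivStarAlg.lift_star _ _ _

end maps

theorem isQutMatrix_u : IsQutMatrix b A (u b A) := by
  intro x y h
  cases h with
  | star_mul_self i j =>
    have := UnivStarAlg.mk_rel (QutRel.star_mul_self (b := b) (A := A)
      (u := fun i j => FreeStarAlg.gen (i, j)) i j)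
    simp only [map_sum, map_mul, UnivStarAlg.mk_star, apply_ite (UnivStarAlg.mk _), map_one,
      map_zero] at this
    exact this
  | mul_star_self i j =>
    have := UnivStarAlg.mk_rel (QutRel.mul_star_self (b := b) (A := A)
      (u := fun i j => FreeStarAlg.gen (i, j)) i j)
    simp only [map_sum, map_mul, UnivStarAlg.mk_star, apply_ite (UnivStarAlg.mk _), map_one,
      map_zero] at this
    exact this
  | mult k i j =>
    have := UnivStarAlg.mk_rel (QutRel.mult (b := b) (A := A)
      (u := fun i j => FreeStarAlg.gen (i, j)) k i j)
    simp only [map_sum, map_mul, map_smul] at this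
    exact this
  | unit i =>
    have := UnivStarAlg.mk_rel (QutRel.unit (b := b) (A := A)
      (u := fun i j => FreeStarAlg.gen (i, j)) i)
    simp only [map_sum, map_smul, map_one] at this
    exact this
  | comm s i j =>
    have := UnivStarAlg.mk_rel (QutRel.comm (b := b) (A := A)
      (u := fun i j => FreeStarAlg.gen (i, j)) s i j)
    simp only [map_sum, map_smul] at this
    exact this

theorem isQutMatrix_map {D E : Type*} [Ring D] [StarRing D] [Algebra ℂ D] [Ring E] [StarRing E]
    [Algebra ℂ E] (φ : D →ₐ[ℂ] E) (hφ : ∀ x, φ (star x) = star (φ x)) {v : ι → ι → D}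
    (hv : IsQutMatrix b A v) : IsQutMatrix b A fun i j => φ (v i j) := by
  intro x y h
  cases h with
  | star_mul_self i j =>
    have := congrArg φ (hv _ _ (.star_mul_self i j))
    simpa only [map_sum, map_mul, hφ, apply_ite φ, map_one, map_zero] using this
  | mul_star_self i j =>
    have := congrArg φ (hv _ _ (.mul_star_self i j))
    simpa only [map_sum, map_mul, hφ, apply_ite φ, map_one, map_zero] using this
  | mult k i j =>
    have := congrArg φ (hv _ _ (.mult k i j))
    simpa only [map_sum, map_mul, map_smul] using this
  | unit i =>
    have := congrArg φ (hv _ _ (.unit i))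
    simpa only [map_sum, map_smul, map_one] using this
  | comm s i j =>
    have := congrArg φ (hv _ _ (.comm s i j))
    simpa only [map_sum, map_smul] using this

/-- The product of two solutions with commuting entries is a solution. -/
theorem isQutMatrix_mul {D : Type*} [Ring D] [StarRing D] [Algebra ℂ D] {v w : ι → ι → D}
    (hv : IsQutMatrix b A v) (hw : IsQutMatrix b A w)
    (hvw : ∀ i j k l, v i j * w k l = w k l * v i j) :
    IsQutMatrix b A fun i j => ∑ k, v i k * w k j := by
  have toM : ∀ z : ι → ι → D, (∀ i j, ∑ k, star (z k i) * z k j = if i = j then 1 else 0) ↔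
      (Matrix.of z).conjTranspose * Matrix.of z = 1 := fun z => by
    rw [← Matrix.ext_iff]
    simp [Matrix.mul_apply, Matrix.one_apply]
  have toM' : ∀ z : ι → ι → D, (∀ i j, ∑ k, z i k * star (z j k) = if i = j then 1 else 0) ↔
      Matrix.of z * (Matrix.of z).conjTranspose = 1 := fun z => by
    rw [← Matrix.ext_iff]
    simp [Matrix.mul_apply, Matrix.one_apply]
  have hmul : Matrix.of (fun i j => ∑ k, v i k * w k j) = Matrix.of v * Matrix.of w := by
    ext i j; simp [Matrix.mul_apply]
  intro x y h
  cases h with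
  | star_mul_self i j =>
    revert i j
    rw [toM, hmul, Matrix.conjTranspose_mul, Matrix.mul_assoc,
      ← Matrix.mul_assoc (Matrix.of v).conjTranspose,
      (toM v).1 fun i j => hv _ _ (.star_mul_self i j), Matrix.one_mul,
      (toM w).1 fun i j => hw _ _ (.star_mul_self i j)]
  | mul_star_self i j =>
    revert i j
    rw [toM', hmul, Matrix.conjTranspose_mul, Matrix.mul_assoc,
      ← Matrix.mul_assoc (Matrix.of w),
      (toM' w).1 fun i j => hw _ _ (.mul_star_self i j), Matrix.one_mul,
      (toM' v).1 fun i j => hv _ _ (.mul_star_self i j)]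
  | mult k i j =>
    have h1 : ∀ p q, (∑ r, v p r * w r i) * (∑ s, v q s * w s j) =
        ∑ r, ∑ s, (v p r * v q s) * (w r i * w s j) := fun p q => by
      rw [Finset.sum_mul_sum]
      refine Finset.sum_congr rfl fun r _ => Finset.sum_congr rfl fun s _ => ?_
      rw [mul_assoc, ← mul_assoc (w r i), ← hvw, mul_assoc, mul_assoc]
    calc ∑ p, ∑ q, inner ℂ (b k) (b p * b q) • ((∑ r, v p r * w r i) * ∑ s, v q s * w s j)
        = ∑ p, ∑ q, ∑ r, ∑ s,
            (inner ℂ (b k) (b p * b q) • (v p r * v q s)) * (w r i * w s j) := by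
          simp only [h1, Finset.smul_sum, smul_mul_assoc]
      _ = ∑ p, ∑ r, ∑ q, ∑ s,
            (inner ℂ (b k) (b p * b q) • (v p r * v q s)) * (w r i * w s j) :=
          Finset.sum_congr rfl fun p _ => Finset.sum_comm
      _ = ∑ r, ∑ p, ∑ s, ∑ q,
            (inner ℂ (b k) (b p * b q) • (v p r * v q s)) * (w r i * w s j) := by
          rw [Finset.sum_comm]
          exact Finset.sum_congr rfl fun r _ => Finset.sum_congr rfl fun p _ => Finset.sum_comm
      _ = ∑ r, ∑ s, (∑ p, ∑ q,
            inner ℂ (b k) (b p * b q) • (v p r * v q s)) * (w r i * w s j) := by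
          refine Finset.sum_congr rfl fun r _ => ?_
          rw [Finset.sum_comm]
          exact Finset.sum_congr rfl fun s _ => by simp only [Finset.sum_mul]
      _ = ∑ r, ∑ s, ∑ l, inner ℂ (b l) (b r * b s) • (v k l * (w r i * w s j)) := by
          refine Finset.sum_congr rfl fun r _ => Finset.sum_congr rfl fun s _ => ?_
          rw [hv _ _ (.mult k r s), Finset.sum_mul]
          simp only [smul_mul_assoc]
      _ = ∑ r, ∑ l, ∑ s, inner ℂ (b l) (b r * b s) • (v k l * (w r i * w s j)) :=
          Finset.sum_congr rfl fun r _ => Finset.sum_comm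
      _ = ∑ l, ∑ r, ∑ s, inner ℂ (b l) (b r * b s) • (v k l * (w r i * w s j)) :=
          Finset.sum_comm
      _ = ∑ l, v k l * ∑ r, ∑ s, inner ℂ (b l) (b r * b s) • (w r i * w s j) := by
          simp only [Finset.mul_sum, mul_smul_comm]
      _ = ∑ l, ∑ r, inner ℂ (b r) (b i * b j) • (v k l * w l r) := by
          refine Finset.sum_congr rfl fun l _ => ?_
          rw [hw _ _ (.mult l i j), Finset.mul_sum]
          simp only [mul_smul_comm]
      _ = ∑ r, inner ℂ (b r) (b i * b j) • ∑ l, v k l * w l r := by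
          rw [Finset.sum_comm]
          simp only [Finset.smul_sum]
  | unit i =>
    calc ∑ j, inner ℂ (b j) (1 : X.L2) • ∑ k, v i k * w k j
        = ∑ k, v i k * ∑ j, inner ℂ (b j) (1 : X.L2) • w k j := by
          simp only [Finset.smul_sum, Finset.mul_sum, mul_smul_comm]
          exact Finset.sum_comm
      _ = ∑ k, inner ℂ (b k) (1 : X.L2) • v i k := by
          refine Finset.sum_congr rfl fun k _ => ?_
          rw [hw _ _ (.unit k), mul_smul_comm, mul_one]
      _ = _ := hv _ _ (.unit i)
  | comm s i j =>
    calc ∑ k, inner ℂ (b k) (A s (b j)) • ∑ l, v i l * w l k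
        = ∑ l, v i l * ∑ k, inner ℂ (b k) (A s (b j)) • w l k := by
          simp only [Finset.smul_sum, Finset.mul_sum, mul_smul_comm]
          exact Finset.sum_comm
      _ = ∑ l, v i l * ∑ k, inner ℂ (b l) (A s (b k)) • w k j := by
          refine Finset.sum_congr rfl fun l _ => ?_
          rw [hw _ _ (.comm s l j)]
      _ = ∑ k, (∑ l, inner ℂ (b l) (A s (b k)) • v i l) * w k j := by
          simp only [Finset.mul_sum, mul_smul_comm, Finset.sum_mul, smul_mul_assoc]
          exact Finset.sum_comm
      _ = ∑ k, (∑ l, inner ℂ (b i) (A s (b l)) • v l k) * w k j := by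
          refine Finset.sum_congr rfl fun k _ => ?_
          rw [hv _ _ (.comm s i k)]
      _ = ∑ k, inner ℂ (b i) (A s (b k)) • ∑ l, v k l * w l j := by
          simp only [Finset.smul_sum, Finset.sum_mul, smul_mul_assoc]
          exact Finset.sum_comm

theorem isQutMatrix_one : IsQutMatrix b A fun i j => if i = j then (1 : ℂ) else 0 := by
  intro x y h
  cases h with
  | star_mul_self i j =>
    have h : ∀ p q : ι, (if p = q then (1 : ℂ) else 0) = if q = p then 1 else 0 :=
      fun p q => if_congr eq_comm rfl rfl
    rw [h i j]
    simp [apply_ite star]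
  | mul_star_self i j => simp [apply_ite star]
  | mult k i j => simp
  | unit i => simp
  | comm s i j => simp

open Algebra.TensorProduct in
theorem isQutMatrix_comul : IsQutMatrix b A
    fun i j => ∑ k, (u b A i k ⊗ₜ[ℂ] 1) * ((1 : QutInterAlg b A) ⊗ₜ[ℂ] u b A k j) :=
  isQutMatrix_mul
    (isQutMatrix_map (includeLeft : _ →ₐ[ℂ] QutInterAlg b A ⊗[ℂ] QutInterAlg b A)
      (fun x => by simp) isQutMatrix_u)
    (isQutMatrix_map (includeRight : _ →ₐ[ℂ] QutInterAlg b A ⊗[ℂ] QutInterAlg b A)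
      (fun x => by simp) isQutMatrix_u)
    (fun i j k l => by simp)

variable (b A)

/-- The comultiplication, `Δ(u i j) = ∑ₖ u i k ⊗ u k j`. -/
def comulHom : QutInterAlg b A →ₐ[ℂ] QutInterAlg b A ⊗[ℂ] QutInterAlg b A :=
  lift _ isQutMatrix_comul

/-- The counit, `ε(u i j) = δ i j`. -/
def counitHom : QutInterAlg b A →ₐ[ℂ] ℂ := lift _ isQutMatrix_one

theorem comulHom_u (i j : ι) :
    comulHom b A (u b A i j) = ∑ k, u b A i k ⊗ₜ[ℂ] u b A k j := by
  rw [comulHom, lift_u]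
  simp

theorem comulHom_star (x : QutInterAlg b A) :
    comulHom b A (star x) = star (comulHom b A x) := lift_star _ _ _

theorem comulHom_star_u (i j : ι) :
    comulHom b A (star (u b A i j)) = ∑ k, star (u b A i k) ⊗ₜ[ℂ] star (u b A k j) := by
  rw [comulHom_star, comulHom_u, star_sum]
  simp

theorem counitHom_u (i j : ι) : counitHom b A (u b A i j) = if i = j then 1 else 0 :=
  lift_u _ _ _ _

theorem counitHom_star_u (i j : ι) :
    counitHom b A (star (u b A i j)) = if i = j then 1 else 0 := by
  rw [counitHom, lift_star, lift_u]
  split_ifs <;> simp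

/-- The quantum group structure on `𝒪(⋂ₛ Qut(𝕏, Aₛ))`. -/
instance : Bialgebra ℂ (QutInterAlg b A) :=
  Bialgebra.ofAlgHom (comulHom b A) (counitHom b A)
    (by
      refine algHom_ext (fun i j => ?_) (fun i j => ?_)
      · simp only [AlgHom.comp_apply, comulHom_u, map_sum, Algebra.TensorProduct.map_tmul,
          AlgHom.id_apply, TensorProduct.sum_tmul, TensorProduct.tmul_sum]
        rw [Finset.sum_comm]
        rfl
      · simp only [AlgHom.comp_apply, comulHom_star_u, map_sum, Algebra.TensorProduct.map_tmul,
          AlgHom.id_apply, TensorProduct.sum_tmul, TensorProduct.tmul_sum]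
        rw [Finset.sum_comm]
        rfl)
    (by
      refine algHom_ext (fun i j => ?_) (fun i j => ?_)
      · simp [comulHom_u, counitHom_u, TensorProduct.ite_tmul]
      · simp [comulHom_star_u, counitHom_star_u, TensorProduct.ite_tmul])
    (by
      refine algHom_ext (fun i j => ?_) (fun i j => ?_)
      · simp [comulHom_u, counitHom_u, TensorProduct.tmul_ite]
      · simp [comulHom_star_u, counitHom_star_u, TensorProduct.tmul_ite])

/-- The canonical action `α : ℓ²(𝕏) → ℓ²(𝕏) ⊗ 𝒪`, `α(bⱼ) = ∑ᵢ bᵢ ⊗ u i j`. -/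
def action : X.L2 →ₗ[ℂ] X.L2 ⊗[ℂ] QutInterAlg b A :=
  b.toBasis.constr ℂ fun j => ∑ i, b i ⊗ₜ[ℂ] u b A i j

end QutInterAlg

/-- The equality `Qut(𝕏 ⊗ ℂᵐ, A') = ⋂ₛ Qut(𝕏, Aₛ)` of quantum groups, with respect to orthonormal
bases `b` of `ℓ²(𝕏)` and `b'` of `ℓ²(𝕏 ⊗ ℂᵐ)`: an isomorphism `Φ` of Hopf *-algebras
`𝒪(Qut(𝕏 ⊗ ℂᵐ, A')) ≅ 𝒪(⋂ₛ Qut(𝕏, Aₛ))` which identifies the canonical action `α'` on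
`𝕏 ⊗ ℂᵐ` with the canonical action `α` on `𝕏` tensored with the trivial action on `ℂᵐ`, i.e. the
`a`-th coordinate of `(id ⊗ Φ)(α' f)` is `α fₐ`. (A bialgebra isomorphism preserves antipodes.) -/
def QutEqInter {m : ℕ} {ι ι' κ : Type*} [Fintype ι] [DecidableEq ι] [Fintype ι'] [DecidableEq ι']
    (b : OrthonormalBasis ι ℂ X.L2) (A : κ → X.L2 →ₗ[ℂ] X.L2)
    (b' : OrthonormalBasis ι' ℂ (X.amplify m).L2)
    (A' : (X.amplify m).L2 →ₗ[ℂ] (X.amplify m).L2) : Prop :=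
  ∃ Φ : QutAlg b' A' ≃ₐc[ℂ] QutInterAlg b A,
    (∀ x, Φ (star x) = star (Φ x)) ∧
    ∀ a : Fin m,
      TensorProduct.map (X.coord a)
          (Φ : QutAlg b' A' →ₗ[ℂ] QutInterAlg b A) ∘ₗ
          QutInterAlg.action b' (fun _ : Unit => A') =
        QutInterAlg.action b A ∘ₗ X.coord a

/-- `A' = I ⊗ B + ∑ᵢ Aᵢ ⊗ Pᵢ` defines a directed quantum graph without loops on `𝕏 ⊗ ℂⁿ⁺¹`, and
`Qut(𝕏 ⊗ ℂⁿ⁺¹, A') = ⋂ᵢ Qut(𝕏, Aᵢ)` (whatever the bases in which `Qut` is presented). -/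
structure CombinesTo (X : FiniteQuantumSet C) {n : ℕ} (A : Fin n → X.L2 →ₗ[ℂ] X.L2)
    (B : Matrix (Fin (n + 1)) (Fin (n + 1)) ℂ) : Prop where
  isQuantumGraph : (X.amplify (n + 1)).IsQuantumGraph (X.combined A B)
  noLoops : (X.amplify (n + 1)).NoLoops (X.combined A B)
  qut_eq : ∀ (k k' : ℕ) (b : OrthonormalBasis (Fin k) ℂ X.L2)
    (b' : OrthonormalBasis (Fin k') ℂ (X.amplify (n + 1)).L2),
    QutEqInter b A b' (X.combined A B)

end FiniteQuantumSet

/-- The adjacency matrix of the simple graph `ℋ` on `{0, 1, …, n}`: the vertex `0` is connected to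
all `i > ⌊n/2⌋`, and distinct nonzero vertices `i, j` are connected if and only if `i + j > n`. -/
def thresholdGraph (n : ℕ) : Matrix (Fin (n + 1)) (Fin (n + 1)) ℂ :=
  Matrix.of fun i j =>
    if i ≠ j ∧ ((i = 0 ∧ n / 2 < (j : ℕ)) ∨ (j = 0 ∧ n / 2 < (i : ℕ)) ∨
      (i ≠ 0 ∧ j ≠ 0 ∧ n < (i : ℕ) + (j : ℕ))) then 1 else 0

end

/-! Put A₀ = 0 and d₀ = 0, and let β be a coaction on C(𝕏) ⊗ ℂⁿ⁺¹ that commutes with A'. Since Aᵢη =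
dᵢη, the operator A' sends 1 ⊗ r to 1 ⊗ (B + diag d) r. Hence the vectors r for which 1 ⊗ r is fixed
by β form a unital subalgebra of ℂⁿ⁺¹ that is stable under B + diag d. If B is chosen so that every
such subalgebra is all of ℂⁿ⁺¹ (`Separating`), then β fixes every central projection 1 ⊗ eₐ and
splits into corners βₐ on the copies of 𝕏.

Comparing blocks of A'β = βA' finishes the analysis (`IsQutCoaction.of_combined`). An off-diagonal
block of A' is 0 or the identity, so an edge of B from either vertex to the other makes the two
corners equal; a vertex joined to all others makes all corners equal to one α. The diagonal block Aᵢ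
then shows that α commutes with Aᵢ. Conversely, every coaction commuting with all Aᵢ amplifies to
one commuting with A'. In matrices, amplification is the injective unital *-homomorphism M ↦ M ⊗ 1,
so unitarity passes both ways, and the universal properties give mutually inverse Hopf
*-isomorphisms (`qutEqInter_combined`).

It remains to find B. A stable subalgebra contains the vector of row sums of B + diag d, and by
interpolation it contains the point mass at any vertex that it separates from the others. For a
transitive tournament ordered by Re d, the row sums already have distinct real parts. In the
threshold graph, vertex v ≥ 1 has degree v and vertex 0 has degree ⌈n/2⌉. As the dᵢ increase, the
row sums at the vertices v ≥ 1 are distinct. Only vertex 0 can collide with a vertex, and positivity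
of the dᵢ confines this to v < ⌈n/2⌉; one further application of B + diag d removes the collision
(`thresholdGraph_separating`). -/

noncomputable section

/-! ### Blocks of operators on `ℓ²(𝕏) ⊗ ℂᵐ` -/

namespace FiniteQuantumSet

variable {C : Type*} [CStarAlgebra C] [FiniteDimensional ℂ C] (X : FiniteQuantumSet C) {m : ℕ}

theorem ext_coord {f g : (X.amplify m).L2} (h : ∀ a, X.coord a f = X.coord a g) : f = g :=
  X.toFaithfulTrace.ext_coord h

theorem coord_mul (a : Fin m) (f g : (X.amplify m).L2) :
    X.coord a (f * g) = X.coord a f * X.coord a g := rfl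

theorem mulMap_tmul (x y : X.L2) : X.mulMap (x ⊗ₜ[ℂ] y) = x * y :=
  LinearMap.mul'_apply

theorem coord_one (a : Fin m) : X.coord a (1 : (X.amplify m).L2) = 1 := rfl

theorem coord_star (a : Fin m) (f : (X.amplify m).L2) :
    X.coord a (star f) = star (X.coord a f) := rfl

theorem coord_incl_self (a : Fin m) (x : X.L2) : X.coord a (X.incl a x) = x := by
  rw [coord_incl, if_pos rfl]

theorem coord_incl_of_ne {a b : Fin m} (h : a ≠ b) (x : X.L2) :
    X.coord a (X.incl b x) = 0 := by
  rw [coord_incl, if_neg h]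

theorem sum_incl_coord (f : (X.amplify m).L2) : ∑ a, X.incl a (X.coord a f) = f :=
  X.toFaithfulTrace.sum_incl_coord f

theorem incl_mul (a : Fin m) (x y : X.L2) : X.incl a (x * y) = X.incl a x * X.incl a y :=
  X.toFaithfulTrace.incl_mul a x y

theorem inner_amplify (f g : (X.amplify m).L2) :
    inner ℂ f g = ∑ a, inner ℂ (X.coord a f) (X.coord a g) :=
  X.toFaithfulTrace.inner_amplify f g

theorem inner_incl_left (a : Fin m) (x : X.L2) (f : (X.amplify m).L2) :
    inner ℂ (X.incl a x) f = inner ℂ x (X.coord a f) :=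
  X.toFaithfulTrace.inner_incl_left a x f

theorem inner_incl_right (a : Fin m) (x : X.L2) (f : (X.amplify m).L2) :
    inner ℂ f (X.incl a x) = inner ℂ (X.coord a f) x := by
  rw [← inner_conj_symm, inner_incl_left, inner_conj_symm]

theorem star_incl (a : Fin m) (x : X.L2) : star (X.incl a x) = X.incl a (star x) := by
  refine X.ext_coord fun b => ?_
  rw [coord_star, coord_incl, coord_incl]
  split_ifs <;> simp

theorem incl_mul_left (a : Fin m) (x : X.L2) (f : (X.amplify m).L2) :
    X.incl a x * f = X.incl a (x * X.coord a f) := by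
  refine X.ext_coord fun b => ?_
  rw [coord_mul, coord_incl, coord_incl]
  split_ifs with h
  · rw [h]
  · rw [zero_mul]

/-- The block `(a, b)` of an operator on `ℓ²(𝕏) ⊗ ℂᵐ`. -/
def block (T : (X.amplify m).L2 →ₗ[ℂ] (X.amplify m).L2) (a b : Fin m) : X.L2 →ₗ[ℂ] X.L2 :=
  X.coord a ∘ₗ T ∘ₗ X.incl b

theorem ext_block {S T : (X.amplify m).L2 →ₗ[ℂ] (X.amplify m).L2}
    (h : ∀ a b, X.block S a b = X.block T a b) : S = T := by
  refine LinearMap.ext fun f => ?_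
  rw [← X.sum_incl_coord f, map_sum, map_sum]
  exact Finset.sum_congr rfl fun b _ => X.ext_coord fun a => LinearMap.congr_fun (h a b) _

theorem block_zero (a b : Fin m) :
    X.block (0 : (X.amplify m).L2 →ₗ[ℂ] (X.amplify m).L2) a b = 0 := by
  refine LinearMap.ext fun x => ?_
  simp [block]

theorem block_id (a b : Fin m) :
    X.block (LinearMap.id : (X.amplify m).L2 →ₗ[ℂ] (X.amplify m).L2) a b =
      if a = b then LinearMap.id else 0 := by
  refine LinearMap.ext fun x => ?_
  rw [block, LinearMap.comp_apply, LinearMap.comp_apply, LinearMap.id_apply, coord_incl]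
  split_ifs <;> rfl

/-- Multiplication is coordinatewise, so its adjoint never mixes different points of ℂᵐ. This is why
Schur products can be taken block by block. -/
theorem adjoint_mulMap_amplify :
    LinearMap.adjoint (X.amplify m).mulMap =
      ∑ a, TensorProduct.map (X.incl a) (X.incl a) ∘ₗ LinearMap.adjoint X.mulMap ∘ₗ
        X.coord a := by
  symm
  rw [LinearMap.eq_adjoint_iff]
  intro f t
  induction t using TensorProduct.induction_on with
  | zero => simp only [map_zero, inner_zero_right]
  | add s t hs ht => rw [inner_add_right, hs, ht, map_add, inner_add_right]
  | tmul g h =>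
    rw [LinearMap.sum_apply, sum_inner, mulMap_tmul, inner_amplify]
    refine Finset.sum_congr rfl fun a _ => ?_
    rw [coord_mul, ← mulMap_tmul, ← LinearMap.adjoint_inner_left]
    rw [LinearMap.comp_apply, LinearMap.comp_apply]
    generalize LinearMap.adjoint X.mulMap (X.coord a f) = s
    induction s using TensorProduct.induction_on with
    | zero => simp only [map_zero, inner_zero_left]
    | add s t hs ht => rw [inner_add_left, map_add, inner_add_left, hs, ht]
    | tmul x y =>
      rw [TensorProduct.map_tmul, TensorProduct.inner_tmul, TensorProduct.inner_tmul,
        inner_incl_left, inner_incl_left]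

/-- Schur products are computed blockwise. -/
theorem block_schur (S T : (X.amplify m).L2 →ₗ[ℂ] (X.amplify m).L2) (a b : Fin m) :
    X.block ((X.amplify m).schur S T) a b = X.schur (X.block S a b) (X.block T a b) := by
  refine LinearMap.ext fun x => ?_
  have h1 : LinearMap.adjoint (X.amplify m).mulMap (X.incl b x) =
      TensorProduct.map (X.incl b) (X.incl b) (LinearMap.adjoint X.mulMap x) := by
    rw [adjoint_mulMap_amplify, LinearMap.sum_apply, Finset.sum_eq_single b]
    · rw [LinearMap.comp_apply, LinearMap.comp_apply, coord_incl_self]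
    · intro c _ h
      rw [LinearMap.comp_apply, LinearMap.comp_apply, coord_incl_of_ne _ h, map_zero, map_zero]
    · simp
  change X.coord a ((X.amplify m).mulMap (TensorProduct.map S T
    (LinearMap.adjoint (X.amplify m).mulMap (X.incl b x)))) = X.mulMap (TensorProduct.map
      (X.block S a b) (X.block T a b) (LinearMap.adjoint X.mulMap x))
  rw [h1]
  generalize LinearMap.adjoint X.mulMap x = s
  induction s using TensorProduct.induction_on with
  | zero => simp only [map_zero]
  | add s t hs ht => simp only [map_add, hs, ht]
  | tmul x y => rfl

theorem block_conj (T : (X.amplify m).L2 →ₗ[ℂ] (X.amplify m).L2) (a b : Fin m) :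
    X.block ((X.amplify m).conj T) a b = X.conj (X.block T a b) := by
  refine LinearMap.ext fun x => ?_
  change X.coord a (star (T (star (X.incl b x)))) = star (X.coord a (T (X.incl b (star x))))
  rw [star_incl, coord_star]

/-- This is the normalisation m m* = id of the trace. It makes the off-diagonal blocks of A' Schur
idempotent. -/
theorem schur_id_id : X.schur LinearMap.id LinearMap.id = LinearMap.id := by
  rw [schur, TensorProduct.map_id, LinearMap.id_comp]
  exact X.one_form

theorem schur_smul_smul (r s : ℂ) (S T : X.L2 →ₗ[ℂ] X.L2) :
    X.schur (r • S) (s • T) = (r * s) • X.schur S T := by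
  rw [schur, schur, TensorProduct.map_smul_left, TensorProduct.map_smul_right, smul_smul,
    LinearMap.smul_comp, LinearMap.comp_smul]

theorem schur_zero_left (T : X.L2 →ₗ[ℂ] X.L2) : X.schur 0 T = 0 := by
  rw [← zero_smul ℂ (0 : X.L2 →ₗ[ℂ] X.L2), ← one_smul ℂ T, schur_smul_smul, zero_mul, zero_smul,
    zero_smul]

theorem schur_zero_right (T : X.L2 →ₗ[ℂ] X.L2) : X.schur T 0 = 0 := by
  rw [← zero_smul ℂ (0 : X.L2 →ₗ[ℂ] X.L2), ← one_smul ℂ T, schur_smul_smul, mul_zero, zero_smul,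
    zero_smul]

section combined

variable {n : ℕ} (A : Fin n → X.L2 →ₗ[ℂ] X.L2) (B : Matrix (Fin (n + 1)) (Fin (n + 1)) ℂ)

/-- Writing `Fin.cons 0 A` places the zero operator at vertex 0, so that all vertices are treated
alike. -/
theorem coord_combined (f : (X.amplify (n + 1)).L2) (a : Fin (n + 1)) :
    X.coord a (X.combined A B f) = ∑ j, B a j • X.coord j f +
      (Fin.cons 0 A : Fin (n + 1) → X.L2 →ₗ[ℂ] X.L2) a (X.coord a f) := by
  rw [combined, LinearMap.add_apply, map_add, coord_tensorOp, LinearMap.sum_apply, map_sum]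
  congr 1
  simp only [coord_tensorOp]
  induction a using Fin.cases with
  | zero =>
    simp [Fin.succ_ne_zero]
  | succ i =>
    rw [Fin.cons_succ, Finset.sum_eq_single i, Finset.sum_eq_single i.succ]
    · simp
    · intro b _ h
      rw [Matrix.single_apply_of_col_ne _ _ h.symm, zero_smul]
    · simp
    · intro j _ h
      refine Finset.sum_eq_zero fun b _ => ?_
      rw [Matrix.single_apply_of_row_ne (fun h' => h (Fin.succ_injective _ h')), zero_smul]
    · simp

theorem block_combined (a b : Fin (n + 1)) :
    X.block (X.combined A B) a b = B a b • LinearMap.id +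
      if a = b then (Fin.cons 0 A : Fin (n + 1) → X.L2 →ₗ[ℂ] X.L2) a else 0 := by
  refine LinearMap.ext fun x => ?_
  rw [block, LinearMap.comp_apply, LinearMap.comp_apply, coord_combined,
    Finset.sum_eq_single b]
  · rw [coord_incl_self, coord_incl]
    split_ifs <;> simp
  · intro c _ h; rw [coord_incl_of_ne _ h, smul_zero]
  · simp

variable {A B}

/-- Both conditions can be checked on blocks. As B has zero diagonal, the diagonal blocks are 0 and
the Aᵢ, while the others are 0 or the identity. -/
theorem isQuantumGraph_combined (hA : ∀ i, X.IsQuantumGraph (A i))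
    (hB : ∀ i j, B i j = 0 ∨ B i j = 1) (hB' : ∀ i, B i i = 0) :
    (X.amplify (n + 1)).IsQuantumGraph (X.combined A B) := by
  have h0 : ∀ a, X.IsQuantumGraph ((Fin.cons 0 A : Fin (n + 1) → X.L2 →ₗ[ℂ] X.L2) a) := by
    intro a
    induction a using Fin.cases with
    | zero =>
      refine ⟨X.schur_zero_left _, LinearMap.ext fun x => ?_⟩
      simp [conj]
    | succ i => exact hA i
  constructor
  · refine X.ext_block fun a b => ?_
    rw [block_schur, block_combined]
    split_ifs with h
    · subst h
      rw [hB', zero_smul, zero_add, (h0 a).schur_idem]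
    · rw [add_zero, schur_smul_smul, schur_id_id]
      rcases hB a b with h | h <;> simp [h]
  · refine X.ext_block fun a b => ?_
    rw [block_conj, block_combined]
    split_ifs with h
    · subst h
      rw [hB', zero_smul, zero_add, (h0 a).real]
    · refine LinearMap.ext fun x => ?_
      rcases hB a b with h | h <;> simp [h, conj]

theorem noLoops_combined (hA : ∀ i, X.NoLoops (A i)) (hB' : ∀ i, B i i = 0) :
    (X.amplify (n + 1)).NoLoops (X.combined A B) := by
  refine X.ext_block fun a b => ?_
  rw [block_schur, block_combined, block_id, block_zero]
  split_ifs with h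
  · subst h
    rw [hB', zero_smul, zero_add]
    induction a using Fin.cases with
    | zero => exact X.schur_zero_left _
    | succ i => exact hA i
  · exact X.schur_zero_right _

end combined

/-! ### Positivity of the degree -/

theorem inner_star_left (x y : X.L2) : inner ℂ (star x) y = inner ℂ (star y) x := by
  rw [FaithfulTrace.inner_def, FaithfulTrace.inner_def, star_star, star_star]
  exact X.tracial x y

/-- Paired with x ⊗ y, the right side gives ⟨y*, x⟩ = ψ(yx) by Parseval, and traciality turns this
into ⟨1, xy⟩. -/
theorem adjoint_mulMap_one {ι : Type*} [Fintype ι] (b : OrthonormalBasis ι ℂ X.L2) :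
    LinearMap.adjoint X.mulMap 1 = ∑ k, b k ⊗ₜ[ℂ] star (b k) := by
  refine ext_inner_right ℂ fun t => ?_
  rw [LinearMap.adjoint_inner_left]
  induction t using TensorProduct.induction_on with
  | zero => simp only [map_zero, inner_zero_right]
  | add s t hs ht => rw [inner_add_right, ← hs, ← ht, map_add, inner_add_right]
  | tmul x y =>
    simp only [sum_inner, TensorProduct.inner_tmul]
    have h : ∀ k, inner ℂ (b k) x * inner ℂ (star (b k)) y =
        inner ℂ (star y) (b k) * inner ℂ (b k) x := fun k => by
      rw [X.inner_star_left (b k) y, mul_comm]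
    rw [Finset.sum_congr rfl fun k _ => h k, b.sum_inner_mul_inner, mulMap_tmul,
      FaithfulTrace.inner_def, FaithfulTrace.inner_def, star_star, star_one, one_mul]
    exact X.tracial x y

/-- `⟨η, A η⟩` is the square of the Hilbert–Schmidt norm of a quantum adjacency matrix `A`. -/
theorem inner_one_apply_one {A : X.L2 →ₗ[ℂ] X.L2} (hA : X.IsQuantumGraph A) {ι : Type*}
    [Fintype ι] (b : OrthonormalBasis ι ℂ X.L2) :
    inner ℂ (1 : X.L2) (A 1) = ∑ k, inner ℂ (A (b k)) (A (b k)) := by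
  -- Expanding A as A • A and using that A is real, the k-th term becomes ψ(A bₖ (A bₖ)*);
  -- traciality exchanges the two factors.
  conv_lhs => rw [← hA.schur_idem]
  rw [schur, LinearMap.comp_apply, LinearMap.comp_apply, X.adjoint_mulMap_one b, map_sum, map_sum,
    inner_sum]
  refine Finset.sum_congr rfl fun k _ => ?_
  have h : A (star (b k)) = star (A (b k)) := by
    have := LinearMap.congr_fun hA.real (star (b k))
    rw [← this]
    simp [conj]
  rw [TensorProduct.map_tmul, h, mulMap_tmul, FaithfulTrace.inner_def,
    FaithfulTrace.inner_def, star_one, one_mul]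
  exact X.tracial _ _

/-- Regularity turns ⟨η, Aη⟩ into d‖η‖², which is thus a sum of the squares ‖A bₖ‖² and vanishes
only for A = 0. -/
theorem IsRegularOfDegree.pos {X : FiniteQuantumSet C} {A : X.L2 →ₗ[ℂ] X.L2} {d : ℝ}
    (h : X.IsRegularOfDegree A d) (hA : X.IsQuantumGraph A) (h0 : A ≠ 0) : 0 < d := by
  let b := stdOrthonormalBasis ℂ X.L2
  have h1 := X.inner_one_apply_one hA b
  rw [h.apply_one, inner_smul_right, inner_self_eq_norm_sq_to_K] at h1
  simp only [inner_self_eq_norm_sq_to_K] at h1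
  have h2 : d * ‖(1 : X.L2)‖ ^ 2 = ∑ k, ‖A (b k)‖ ^ 2 := by
    apply Complex.ofReal_injective
    push_cast
    exact h1
  have h3 : 0 < ∑ k, ‖A (b k)‖ ^ 2 := by
    refine lt_of_le_of_ne (Finset.sum_nonneg fun k _ => sq_nonneg _) fun h3 => h0 ?_
    refine b.toBasis.ext fun k => ?_
    have := (Finset.sum_eq_zero_iff_of_nonneg fun k _ => sq_nonneg _).1 h3.symm k
      (Finset.mem_univ k)
    simpa using this
  rw [← h2] at h3
  exact pos_of_mul_pos_left h3 (sq_nonneg _)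

end FiniteQuantumSet

/-! ### Slices and coefficient matrices -/

section slice

variable {E F D D' : Type*} [NormedAddCommGroup E] [InnerProductSpace ℂ E]
  [NormedAddCommGroup F] [InnerProductSpace ℂ F] [Ring D] [Algebra ℂ D] [Ring D'] [Algebra ℂ D']
  {ι : Type*} [Fintype ι]

/-- The slice map `⟨x| ⊗ id : E ⊗ D → D`. -/
def slice (x : E) : E ⊗[ℂ] D →ₗ[ℂ] D :=
  (TensorProduct.lid ℂ D).toLinearMap ∘ₗ LinearMap.rTensor D (innerSL ℂ x).toLinearMap

theorem slice_tmul (x y : E) (d : D) : slice x (y ⊗ₜ[ℂ] d) = inner ℂ x y • d := rfl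

theorem sum_tmul_slice (b : OrthonormalBasis ι ℂ E) (s : E ⊗[ℂ] D) :
    ∑ i, b i ⊗ₜ[ℂ] slice (b i) s = s := by
  induction s using TensorProduct.induction_on with
  | zero => simp
  | add s t hs ht => simp only [map_add, TensorProduct.tmul_add, Finset.sum_add_distrib, hs, ht]
  | tmul x d =>
    simp only [slice_tmul, ← TensorProduct.smul_tmul, ← TensorProduct.sum_tmul]
    rw [b.sum_repr']

theorem slice_eq_sum (b : OrthonormalBasis ι ℂ E) (x : E) (s : E ⊗[ℂ] D) :
    slice x s = ∑ i, inner ℂ x (b i) • slice (b i) s := by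
  conv_lhs => rw [← sum_tmul_slice b s]
  simp only [map_sum, slice_tmul]

theorem ext_slice (b : OrthonormalBasis ι ℂ E) {s t : E ⊗[ℂ] D}
    (h : ∀ i, slice (b i) s = slice (b i) t) : s = t := by
  rw [← sum_tmul_slice b s, ← sum_tmul_slice b t]
  exact Finset.sum_congr rfl fun i _ => by rw [h i]

/-- Here x' plays the role of T* x; the hypothesis states just the instance of adjointness that is
needed. -/
theorem slice_rTensor {T : E →ₗ[ℂ] F} {x : F} {x' : E}
    (h : ∀ y, inner ℂ x (T y) = inner ℂ x' y) (s : E ⊗[ℂ] D) :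
    slice x (T.rTensor D s) = slice x' s := by
  induction s using TensorProduct.induction_on with
  | zero => simp
  | add s t hs ht => simp only [map_add, hs, ht]
  | tmul y d => rw [LinearMap.rTensor_tmul, slice_tmul, slice_tmul, h]

theorem slice_lTensor (x : E) (φ : D →ₗ[ℂ] D') (s : E ⊗[ℂ] D) :
    slice x (φ.lTensor E s) = φ (slice x s) := by
  induction s using TensorProduct.induction_on with
  | zero => simp
  | add s t hs ht => simp only [map_add, hs, ht]
  | tmul y d => rw [LinearMap.lTensor_tmul, slice_tmul, slice_tmul, map_smul]

/-- The map `E → E ⊗ D` with coefficient matrix `v`. -/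
def coactionMap (b : OrthonormalBasis ι ℂ E) (v : ι → ι → D) : E →ₗ[ℂ] E ⊗[ℂ] D :=
  b.toBasis.constr ℂ fun j => ∑ i, b i ⊗ₜ[ℂ] v i j

theorem coactionMap_apply (b : OrthonormalBasis ι ℂ E) (v : ι → ι → D) (j : ι) :
    coactionMap b v (b j) = ∑ i, b i ⊗ₜ[ℂ] v i j := by
  rw [← b.coe_toBasis, coactionMap, Module.Basis.constr_basis, b.coe_toBasis]

/-- The coefficient matrix of a map `E → E ⊗ D`. -/
def coeffMatrix (b : OrthonormalBasis ι ℂ E) (α : E →ₗ[ℂ] E ⊗[ℂ] D) : Matrix ι ι D :=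
  Matrix.of fun i j => slice (b i) (α (b j))

theorem coeffMatrix_apply (b : OrthonormalBasis ι ℂ E) (α : E →ₗ[ℂ] E ⊗[ℂ] D) (i j : ι) :
    coeffMatrix b α i j = slice (b i) (α (b j)) := rfl

theorem ext_orthonormalBasis (b : OrthonormalBasis ι ℂ E) {V : Type*} [AddCommMonoid V]
    [Module ℂ V] {S T : E →ₗ[ℂ] V} (h : ∀ i, S (b i) = T (b i)) : S = T :=
  b.toBasis.ext fun i => by rw [b.coe_toBasis, h]

theorem coactionMap_coeffMatrix (b : OrthonormalBasis ι ℂ E) (α : E →ₗ[ℂ] E ⊗[ℂ] D) :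
    coactionMap b (fun i j => coeffMatrix b α i j) = α :=
  ext_orthonormalBasis b fun j => by
    rw [coactionMap_apply]; exact sum_tmul_slice b _

theorem slice_coactionMap (b : OrthonormalBasis ι ℂ E) (v : ι → ι → D)
    (i j : ι) : slice (b i) (coactionMap b v (b j)) = v i j := by
  classical
  rw [coactionMap_apply, map_sum]
  simp [slice_tmul, b.inner_eq_ite]

theorem lTensor_coactionMap (b : OrthonormalBasis ι ℂ E) (v : ι → ι → D) (φ : D →ₗ[ℂ] D') :
    φ.lTensor E ∘ₗ coactionMap b v = coactionMap b fun i j => φ (v i j) :=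
  ext_orthonormalBasis b fun j => by
    rw [LinearMap.comp_apply, coactionMap_apply, coactionMap_apply, map_sum]
    rfl

end slice

namespace FiniteQuantumSet

variable {C : Type*} [CStarAlgebra C] [FiniteDimensional ℂ C] {X : FiniteQuantumSet C}

/-! ### Coordinate-free form of the defining relations -/

/-- `α : ℓ²(𝕏) → ℓ²(𝕏) ⊗ D` is a unital algebra homomorphism that intertwines the `Aₛ`. -/
structure IsQutCoaction {κ D : Type*} [Ring D] [Algebra ℂ D] (A : κ → X.L2 →ₗ[ℂ] X.L2)
    (α : X.L2 →ₗ[ℂ] X.L2 ⊗[ℂ] D) : Prop where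
  map_mul : ∀ x y, α (x * y) = α x * α y
  map_one : α 1 = 1
  comm : ∀ s x, α (A s x) = (A s).rTensor D (α x)

section matrix

variable {ι κ D : Type*} [Fintype ι] [Ring D] [Algebra ℂ D]
  {b : OrthonormalBasis ι ℂ X.L2} {A : κ → X.L2 →ₗ[ℂ] X.L2} {v : ι → ι → D}

theorem slice_coactionMap_eq_sum (i : ι) (x : X.L2) :
    slice (b i) (coactionMap b v x) = ∑ k, inner ℂ (b k) x • v i k := by
  conv_lhs => rw [← b.sum_repr' x]
  simp only [map_sum, map_smul, slice_coactionMap]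

theorem slice_rTensor_coactionMap (T : X.L2 →ₗ[ℂ] X.L2) (i j : ι) :
    slice (b i) (T.rTensor D (coactionMap b v (b j))) = ∑ k, inner ℂ (b i) (T (b k)) • v k j := by
  simp only [coactionMap_apply, map_sum, LinearMap.rTensor_tmul, slice_tmul]

theorem slice_coactionMap_mul (k i j : ι) :
    slice (b k) (coactionMap b v (b i) * coactionMap b v (b j)) =
      ∑ p, ∑ q, inner ℂ (b k) (b p * b q) • (v p i * v q j) := by
  simp only [coactionMap_apply, Finset.sum_mul_sum, map_sum, Algebra.TensorProduct.tmul_mul_tmul,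
    slice_tmul]

theorem coactionMap_mul_of_basis
    (h : ∀ i j, coactionMap b v (b i * b j) = coactionMap b v (b i) * coactionMap b v (b j))
    (x y : X.L2) : coactionMap b v (x * y) = coactionMap b v x * coactionMap b v y := by
  rw [← b.sum_repr' x, ← b.sum_repr' y]
  simp only [Finset.sum_mul_sum, map_sum, smul_mul_smul_comm, map_smul, h]

variable [DecidableEq ι] [StarRing D]

/-- The multiplicativity, unit and intertwining relations are the coordinates of basis-free
identities for v ↦ α. Only unitarity remains a condition on the matrix, so changes of basis matter
for it alone. -/
theorem isQutMatrix_iff :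
    IsQutMatrix b A v ↔ IsQutCoaction A (coactionMap b v) ∧
      Matrix.of v ∈ unitary (Matrix ι ι D) := by
  have toM : (∀ i j, ∑ k, star (v k i) * v k j = if i = j then 1 else 0) ↔
      star (Matrix.of v) * Matrix.of v = 1 := by
    rw [← Matrix.ext_iff]
    simp [Matrix.mul_apply, Matrix.one_apply, Matrix.star_eq_conjTranspose]
  have toM' : (∀ i j, ∑ k, v i k * star (v j k) = if i = j then 1 else 0) ↔
      Matrix.of v * star (Matrix.of v) = 1 := by
    rw [← Matrix.ext_iff]
    simp [Matrix.mul_apply, Matrix.one_apply, Matrix.star_eq_conjTranspose]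
  have hone : ∀ i, slice (b i) (1 : X.L2 ⊗[ℂ] D) = inner ℂ (b i) (1 : X.L2) • 1 := fun i => by
    rw [Algebra.TensorProduct.one_def, slice_tmul]
  constructor
  · intro h
    refine ⟨⟨fun x y => ?_, ?_, fun s x => ?_⟩, ?_⟩
    · refine coactionMap_mul_of_basis (fun i j => ext_slice b fun k => ?_) x y
      rw [slice_coactionMap_mul, slice_coactionMap_eq_sum, h _ _ (.mult k i j)]
    · refine ext_slice b fun i => ?_
      rw [hone, slice_coactionMap_eq_sum]
      exact h _ _ (.unit i)
    · have : coactionMap b v ∘ₗ A s = (A s).rTensor D ∘ₗ coactionMap b v := by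
        refine ext_orthonormalBasis b fun j => ext_slice b fun i => ?_
        rw [LinearMap.comp_apply, LinearMap.comp_apply, slice_rTensor_coactionMap,
          slice_coactionMap_eq_sum]
        exact h _ _ (.comm s i j)
      exact LinearMap.congr_fun this x
    · exact ⟨toM.1 fun i j => h _ _ (.star_mul_self i j),
        toM'.1 fun i j => h _ _ (.mul_star_self i j)⟩
  · rintro ⟨h, hu⟩ x y hxy
    cases hxy with
    | star_mul_self i j => exact toM.2 hu.1 i j
    | mul_star_self i j => exact toM'.2 hu.2 i j
    | mult k i j =>
      rw [← slice_coactionMap_mul, ← h.map_mul, slice_coactionMap_eq_sum]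
    | unit i => rw [← slice_coactionMap_eq_sum, h.map_one, hone]
    | comm s i j =>
      rw [← slice_coactionMap_eq_sum, h.comm, slice_rTensor_coactionMap]

theorem isQutMatrix_coeffMatrix_iff {α : X.L2 →ₗ[ℂ] X.L2 ⊗[ℂ] D} :
    IsQutMatrix b A (fun i j => coeffMatrix b α i j) ↔ IsQutCoaction A α ∧
      coeffMatrix b α ∈ unitary (Matrix ι ι D) := by
  rw [isQutMatrix_iff, coactionMap_coeffMatrix]
  rfl

end matrix

/-! ### Amplification of coactions -/

section amplify

variable {D : Type*} [Ring D] [Algebra ℂ D] {m : ℕ}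

/-- The coaction `α` on `ℓ²(𝕏)` tensored with the trivial coaction on `ℂᵐ`. -/
def amplifyCoaction (m : ℕ) (α : X.L2 →ₗ[ℂ] X.L2 ⊗[ℂ] D) :
    (X.amplify m).L2 →ₗ[ℂ] (X.amplify m).L2 ⊗[ℂ] D :=
  ∑ a, (X.incl a).rTensor D ∘ₗ α ∘ₗ X.coord a

/-- The corner `(a, a)` of a map `ℓ²(𝕏 ⊗ ℂᵐ) → ℓ²(𝕏 ⊗ ℂᵐ) ⊗ D`. -/
def cornerCoaction (a : Fin m) (β : (X.amplify m).L2 →ₗ[ℂ] (X.amplify m).L2 ⊗[ℂ] D) :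
    X.L2 →ₗ[ℂ] X.L2 ⊗[ℂ] D :=
  (X.coord a).rTensor D ∘ₗ β ∘ₗ X.incl a

theorem rTensor_coord_incl (a b : Fin m) (s : X.L2 ⊗[ℂ] D) :
    (X.coord a).rTensor D ((X.incl b).rTensor D s) = if a = b then s else 0 := by
  induction s using TensorProduct.induction_on with
  | zero => simp
  | add s t hs ht => rw [map_add, map_add, hs, ht]; split_ifs <;> simp
  | tmul x d =>
    rw [LinearMap.rTensor_tmul, LinearMap.rTensor_tmul, coord_incl]
    split_ifs <;> simp

theorem sum_rTensor_incl_coord (s : (X.amplify m).L2 ⊗[ℂ] D) :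
    ∑ a, (X.incl a).rTensor D ((X.coord a).rTensor D s) = s := by
  induction s using TensorProduct.induction_on with
  | zero => simp
  | add s t hs ht => simp only [map_add, Finset.sum_add_distrib, hs, ht]
  | tmul x d =>
    simp only [LinearMap.rTensor_tmul, ← TensorProduct.sum_tmul, sum_incl_coord]

theorem ext_rTensor_coord {s t : (X.amplify m).L2 ⊗[ℂ] D}
    (h : ∀ a, (X.coord a).rTensor D s = (X.coord a).rTensor D t) : s = t := by
  rw [← sum_rTensor_incl_coord s, ← sum_rTensor_incl_coord t]
  exact Finset.sum_congr rfl fun a _ => by rw [h a]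

theorem rTensor_coord_mul (a : Fin m) (s t : (X.amplify m).L2 ⊗[ℂ] D) :
    (X.coord a).rTensor D (s * t) = (X.coord a).rTensor D s * (X.coord a).rTensor D t := by
  induction s using TensorProduct.induction_on with
  | zero => simp
  | add s s' hs hs' => rw [add_mul, map_add, map_add, add_mul, hs, hs']
  | tmul x d =>
    induction t using TensorProduct.induction_on with
    | zero => simp
    | add t t' ht ht' => rw [mul_add, map_add, map_add, mul_add, ht, ht']
    | tmul y e =>
      rw [Algebra.TensorProduct.tmul_mul_tmul, LinearMap.rTensor_tmul, LinearMap.rTensor_tmul,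
        LinearMap.rTensor_tmul, Algebra.TensorProduct.tmul_mul_tmul, coord_mul]

theorem rTensor_coord_amplifyCoaction (α : X.L2 →ₗ[ℂ] X.L2 ⊗[ℂ] D) (a : Fin m)
    (f : (X.amplify m).L2) :
    (X.coord a).rTensor D (amplifyCoaction m α f) = α (X.coord a f) := by
  rw [amplifyCoaction, LinearMap.sum_apply, map_sum, Finset.sum_eq_single a]
  · rw [LinearMap.comp_apply, rTensor_coord_incl, if_pos rfl, LinearMap.comp_apply]
  · intro b _ h
    rw [LinearMap.comp_apply, rTensor_coord_incl, if_neg h.symm]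
  · simp

theorem cornerCoaction_amplifyCoaction (α : X.L2 →ₗ[ℂ] X.L2 ⊗[ℂ] D) (a : Fin m) :
    cornerCoaction a (amplifyCoaction m α) = α := by
  refine LinearMap.ext fun x => ?_
  rw [cornerCoaction, LinearMap.comp_apply, LinearMap.comp_apply, rTensor_coord_amplifyCoaction,
    coord_incl_self]

section lTensor

variable {D' : Type*} [Ring D'] [Algebra ℂ D'] (φ : D →ₗ[ℂ] D')

theorem lTensor_rTensor {E F : Type*} [AddCommGroup E] [Module ℂ E] [AddCommGroup F] [Module ℂ F]
    (T : E →ₗ[ℂ] F) (s : E ⊗[ℂ] D) :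
    φ.lTensor F (T.rTensor D s) = T.rTensor D' (φ.lTensor E s) := by
  induction s using TensorProduct.induction_on with
  | zero => simp
  | add s t hs ht => simp only [map_add, hs, ht]
  | tmul x d => rfl

theorem lTensor_amplifyCoaction (α : X.L2 →ₗ[ℂ] X.L2 ⊗[ℂ] D) :
    φ.lTensor _ ∘ₗ amplifyCoaction m α = amplifyCoaction m (φ.lTensor _ ∘ₗ α) := by
  refine LinearMap.ext fun f => ?_
  simp only [amplifyCoaction, LinearMap.comp_apply, LinearMap.sum_apply, map_sum,
    lTensor_rTensor]

theorem lTensor_cornerCoaction (a : Fin m)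
    (β : (X.amplify m).L2 →ₗ[ℂ] (X.amplify m).L2 ⊗[ℂ] D) :
    φ.lTensor _ ∘ₗ cornerCoaction a β = cornerCoaction a (φ.lTensor _ ∘ₗ β) := by
  refine LinearMap.ext fun f => ?_
  simp only [cornerCoaction, LinearMap.comp_apply, lTensor_rTensor]

end lTensor

/-- The amplification of a coaction intertwines `A' = I ⊗ B + ∑ᵢ Aᵢ ⊗ Pᵢ`. -/
theorem IsQutCoaction.amplify {n : ℕ} {A : Fin n → X.L2 →ₗ[ℂ] X.L2}
    {α : X.L2 →ₗ[ℂ] X.L2 ⊗[ℂ] D} (h : IsQutCoaction A α)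
    (B : Matrix (Fin (n + 1)) (Fin (n + 1)) ℂ) :
    IsQutCoaction (fun _ : Unit => X.combined A B) (amplifyCoaction (n + 1) α) where
  map_mul f g := by
    refine ext_rTensor_coord fun a => ?_
    rw [rTensor_coord_mul, rTensor_coord_amplifyCoaction, rTensor_coord_amplifyCoaction,
      rTensor_coord_amplifyCoaction, coord_mul, h.map_mul]
  map_one := by
    refine ext_rTensor_coord fun a => ?_
    rw [rTensor_coord_amplifyCoaction, coord_one, h.map_one]
    rfl
  comm _ f := by
    refine ext_rTensor_coord fun a => ?_
    have h0 : ∀ x, α ((Fin.cons 0 A : Fin (n + 1) → X.L2 →ₗ[ℂ] X.L2) a x) =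
        ((Fin.cons 0 A : Fin (n + 1) → X.L2 →ₗ[ℂ] X.L2) a).rTensor D (α x) := fun x => by
      induction a using Fin.cases with
      | zero => simp
      | succ i => exact h.comm i x
    -- The coordinate formula for A', read as an identity of linear maps and tensored with D.
    have h1 : ∀ s : (X.amplify (n + 1)).L2 ⊗[ℂ] D,
        (X.coord a).rTensor D ((X.combined A B).rTensor D s) =
        ∑ j, B a j • (X.coord j).rTensor D s +
          ((Fin.cons 0 A : Fin (n + 1) → X.L2 →ₗ[ℂ] X.L2) a).rTensor D
            ((X.coord a).rTensor D s) := fun s => by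
      have : X.coord a ∘ₗ X.combined A B = ∑ j, B a j • X.coord j +
          (Fin.cons 0 A : Fin (n + 1) → X.L2 →ₗ[ℂ] X.L2) a ∘ₗ X.coord a :=
        LinearMap.ext fun f => by
          simp [coord_combined, LinearMap.sum_apply]
      rw [← LinearMap.rTensor_comp_apply, this, LinearMap.rTensor_add, LinearMap.add_apply,
        LinearMap.rTensor_comp_apply, ← LinearMap.coe_rTensorHom, map_sum, LinearMap.sum_apply]
      simp
    rw [h1, rTensor_coord_amplifyCoaction, coord_combined, map_add, map_sum, h0,
      rTensor_coord_amplifyCoaction]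
    simp only [map_smul, rTensor_coord_amplifyCoaction]

end amplify

/-! ### Coefficient matrices of amplified coactions -/

section embed

variable {m : ℕ} {ι ι' : Type*} [Fintype ι] [Fintype ι']
  (b : OrthonormalBasis ι ℂ X.L2) (b' : OrthonormalBasis ι' ℂ (X.amplify m).L2)
  (D : Type*) [Ring D] [StarRing D] [Algebra ℂ D]

/-- The matrix of the inclusion `x ↦ x ⊗ eₐ`, with entries in `D`. -/
def inclMatrix (a : Fin m) : Matrix ι' ι D :=
  Matrix.of fun I i => algebraMap ℂ D (inner ℂ (b' I) (X.incl a (b i)))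

variable {D} in
/-- The matrix `M ⊗ 1` in the basis `b'`. -/
def amplifyMatrix (M : Matrix ι ι D) : Matrix ι' ι' D :=
  ∑ a, inclMatrix b b' D a * M * (inclMatrix b b' D a).conjTranspose

variable {D} in
theorem amplifyMatrix_star (M : Matrix ι ι D) :
    amplifyMatrix b b' (star M) = star (amplifyMatrix b b' M) := by
  simp only [amplifyMatrix, Matrix.star_eq_conjTranspose, Matrix.conjTranspose_sum,
    Matrix.conjTranspose_mul, Matrix.conjTranspose_conjTranspose, Matrix.mul_assoc]

variable [StarModule ℂ D]

theorem inclMatrix_conjTranspose_apply (a : Fin m) (i : ι) (I : ι') :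
    (inclMatrix b b' D a).conjTranspose i I =
      algebraMap ℂ D (inner ℂ (X.incl a (b i)) (b' I)) := by
  rw [Matrix.conjTranspose_apply, inclMatrix, Matrix.of_apply, ← algebraMap_star_comm,
    ← starRingEnd_apply, inner_conj_symm]

/-- The inclusions are isometries with mutually orthogonal ranges. Together with the completeness
relation below, this makes amplification a unital *-homomorphism of matrix algebras. -/
theorem inclMatrix_conjTranspose_mul [DecidableEq ι] (a c : Fin m) :
    (inclMatrix b b' D a).conjTranspose * inclMatrix b b' D c = if a = c then 1 else 0 := by
  ext i j
  rw [Matrix.mul_apply]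
  simp only [inclMatrix_conjTranspose_apply]
  simp only [inclMatrix, Matrix.of_apply, ← map_mul, ← map_sum]
  rw [b'.sum_inner_mul_inner, inner_incl_left, coord_incl]
  split_ifs with h
  · rw [b.inner_eq_ite, Matrix.one_apply]
    split_ifs <;> simp
  · simp

theorem sum_inclMatrix_mul_conjTranspose [DecidableEq ι'] :
    ∑ a, inclMatrix b b' D a * (inclMatrix b b' D a).conjTranspose = 1 := by
  ext I J
  rw [Matrix.sum_apply]
  simp only [Matrix.mul_apply, inclMatrix_conjTranspose_apply]
  simp only [inclMatrix, Matrix.of_apply, ← map_mul, ← map_sum, inner_incl_left, inner_incl_right,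
    b.sum_inner_mul_inner]
  rw [← inner_amplify, b'.inner_eq_ite, Matrix.one_apply]
  split_ifs <;> simp

variable {D}

theorem amplifyMatrix_mul [DecidableEq ι] (M N : Matrix ι ι D) :
    amplifyMatrix b b' (M * N) = amplifyMatrix b b' M * amplifyMatrix b b' N := by
  rw [amplifyMatrix, amplifyMatrix, amplifyMatrix, Finset.sum_mul_sum]
  refine Finset.sum_congr rfl fun a _ => ?_
  have h : ∀ c, inclMatrix b b' D a * M * (inclMatrix b b' D a).conjTranspose *
      (inclMatrix b b' D c * N * (inclMatrix b b' D c).conjTranspose) =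
      if a = c then inclMatrix b b' D a * (M * N) * (inclMatrix b b' D c).conjTranspose
        else 0 := fun c => by
    have : inclMatrix b b' D a * M * (inclMatrix b b' D a).conjTranspose *
      (inclMatrix b b' D c * N * (inclMatrix b b' D c).conjTranspose) = inclMatrix b b' D a * M *
      ((inclMatrix b b' D a).conjTranspose * inclMatrix b b' D c) * N *
        (inclMatrix b b' D c).conjTranspose := by simp only [Matrix.mul_assoc]
    rw [this, inclMatrix_conjTranspose_mul]
    split_ifs <;> simp [Matrix.mul_assoc]
  simp [h]

theorem amplifyMatrix_one [DecidableEq ι] [DecidableEq ι'] : amplifyMatrix b b' (1 : Matrix ι ι D) = 1 := by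
  simp only [amplifyMatrix, Matrix.mul_one, sum_inclMatrix_mul_conjTranspose]

/-- Compression to the a-th summand recovers M. The index a is there because some summand must
exist. -/
theorem amplifyMatrix_injective [DecidableEq ι] (a : Fin m) :
    Function.Injective (amplifyMatrix (D := D) b b') := by
  have h : ∀ M : Matrix ι ι D, (inclMatrix b b' D a).conjTranspose * amplifyMatrix b b' M *
      inclMatrix b b' D a = M := fun M => by
    rw [amplifyMatrix, Matrix.mul_sum, Matrix.sum_mul, Finset.sum_eq_single a]
    · have : (inclMatrix b b' D a).conjTranspose *
        (inclMatrix b b' D a * M * (inclMatrix b b' D a).conjTranspose) * inclMatrix b b' D a =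
        ((inclMatrix b b' D a).conjTranspose * inclMatrix b b' D a) * M *
        ((inclMatrix b b' D a).conjTranspose * inclMatrix b b' D a) := by
        simp only [Matrix.mul_assoc]
      rw [this, inclMatrix_conjTranspose_mul, if_pos rfl, Matrix.one_mul, Matrix.mul_one]
    · intro c _ hc
      rw [← Matrix.mul_assoc, ← Matrix.mul_assoc, inclMatrix_conjTranspose_mul, if_neg hc.symm,
        Matrix.zero_mul, Matrix.zero_mul, Matrix.zero_mul]
    · simp
  exact Function.LeftInverse.injective (g := fun N =>
    (inclMatrix b b' D a).conjTranspose * N * inclMatrix b b' D a) h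

/-- An injective unital *-homomorphism preserves and reflects unitarity. One direction serves to
construct Φ, the other to construct its inverse. -/
theorem amplifyMatrix_mem_unitary_iff [DecidableEq ι] [DecidableEq ι'] (a : Fin m) (M : Matrix ι ι D) :
    amplifyMatrix b b' M ∈ unitary (Matrix ι' ι' D) ↔ M ∈ unitary (Matrix ι ι D) := by
  rw [Unitary.mem_iff, Unitary.mem_iff, ← amplifyMatrix_star, ← amplifyMatrix_mul,
    ← amplifyMatrix_mul, ← amplifyMatrix_one b b', (amplifyMatrix_injective b b' a).eq_iff,
    (amplifyMatrix_injective b b' a).eq_iff]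

/-- The inclusion matrices have scalar entries, which every algebra homomorphism fixes. Applied to Δ
and ε, this gives compatibility with the coalgebra structures. -/
theorem amplifyMatrix_map {D' : Type*} [Ring D'] [StarRing D'] [Algebra ℂ D'] [StarModule ℂ D']
    (φ : D →ₐ[ℂ] D') (M : Matrix ι ι D) :
    (amplifyMatrix b b' M).map φ = amplifyMatrix b b' (M.map φ) := by
  ext I J
  simp only [amplifyMatrix, Matrix.map_apply, Matrix.sum_apply, Matrix.mul_apply, map_sum, map_mul,
    inclMatrix_conjTranspose_apply]
  simp [inclMatrix]

theorem coeffMatrix_amplifyCoaction (α : X.L2 →ₗ[ℂ] X.L2 ⊗[ℂ] D) :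
    coeffMatrix b' (amplifyCoaction m α) = amplifyMatrix b b' (coeffMatrix b α) := by
  ext I J
  rw [coeffMatrix_apply, amplifyCoaction, LinearMap.sum_apply, map_sum, amplifyMatrix,
    Matrix.sum_apply]
  refine Finset.sum_congr rfl fun a _ => ?_
  rw [LinearMap.comp_apply, slice_rTensor (fun y => X.inner_incl_right a y (b' I)),
    LinearMap.comp_apply, slice_eq_sum b]
  have h : ∀ i, slice (b i) (α (X.coord a (b' J))) =
      ∑ j, inner ℂ (b j) (X.coord a (b' J)) • coeffMatrix b α i j := fun i => by
    conv_lhs => rw [← b.sum_repr' (X.coord a (b' J))]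
    simp only [map_sum, map_smul, coeffMatrix_apply]
  simp only [h, Matrix.mul_apply, inclMatrix_conjTranspose_apply, Finset.smul_sum,
    Finset.sum_mul]
  rw [Finset.sum_comm]
  refine Finset.sum_congr rfl fun j _ => Finset.sum_congr rfl fun i _ => ?_
  rw [← Algebra.commutes, ← Algebra.smul_def, inner_incl_left, inclMatrix, Matrix.of_apply,
    ← Algebra.smul_def, inner_incl_right, smul_comm]

end embed

end FiniteQuantumSet

/-! ### Subalgebras of `ℂᵐ` and row sums -/

/-- Lagrange interpolation: for each b ≠ a, an element separating a from b is normalised to be 1 at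
a and 0 at b, and these are multiplied. -/
theorem single_mem_of_separates {V : Type*} [Fintype V] [DecidableEq V]
    (R : Subalgebra ℂ (V → ℂ)) (a : V) (h : ∀ b, b ≠ a → ∃ r ∈ R, r a ≠ r b) :
    Pi.single a 1 ∈ R := by
  choose! r hr hrab using h
  have h1 : ∏ b ∈ Finset.univ.erase a, ((r b a - r b b)⁻¹ • (r b - algebraMap ℂ _ (r b b))) ∈ R :=
    R.prod_mem fun b hb => R.smul_mem (R.sub_mem (hr b (Finset.ne_of_mem_erase hb))
      (R.algebraMap_mem _)) _
  convert h1 using 1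
  ext c
  rw [Finset.prod_apply]
  by_cases hc : c = a
  · subst hc
    rw [Pi.single_eq_same, Finset.prod_eq_one]
    intro b hb
    simp [inv_mul_cancel₀ (sub_ne_zero.2 (hrab b (Finset.ne_of_mem_erase hb)))]
  · rw [Pi.single_eq_of_ne hc, Finset.prod_eq_zero (Finset.mem_erase.2 ⟨hc, Finset.mem_univ c⟩)]
    simp

/-- The action of `B + diag(d)` on `ℂ^V`. -/
def weightedMulVec {V : Type*} [Fintype V] (B : Matrix V V ℂ) (d r : V → ℂ) : V → ℂ :=
  fun a => ∑ j, B a j * r j + d a * r a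

/-- Every subalgebra of `ℂ^V` that is stable under `B + diag(d)` contains all point masses. -/
def Separating {V : Type*} [Fintype V] [DecidableEq V] (B : Matrix V V ℂ) (d : V → ℂ) : Prop :=
  ∀ R : Subalgebra ℂ (V → ℂ), (∀ r ∈ R, weightedMulVec B d r ∈ R) → ∀ a, Pi.single a 1 ∈ R

theorem rowSum_mem {V : Type*} [Fintype V] {B : Matrix V V ℂ} {d : V → ℂ}
    {R : Subalgebra ℂ (V → ℂ)} (h : ∀ r ∈ R, weightedMulVec B d r ∈ R) :
    (fun a => ∑ j, B a j + d a) ∈ R := by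
  convert h 1 R.one_mem using 1
  funext a
  simp [weightedMulVec]

/-! ### Transitive tournaments separate vertices for arbitrary complex degrees -/

section tournament

variable {m : ℕ} (d : Fin m → ℂ)

/-- Sorting key: real part of `d`, ties broken by the index. -/
def sortKey (i : Fin m) : ℝ ×ₗ Fin m := toLex ((d i).re, i)

theorem sortKey_injective : Function.Injective (sortKey d) := fun _ _ h =>
  congrArg Prod.snd (toLex.injective h)

/-- The transitive tournament with edges from every vertex to those of smaller key. -/
def tournament : Matrix (Fin m) (Fin m) ℂ :=
  Matrix.of fun i j => if sortKey d j < sortKey d i then 1 else 0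

/-- Along the order of the keys, the number of smaller vertices increases strictly and Re d weakly.
Hence the row sums of B + diag d have distinct real parts. -/
theorem tournament_separating : Separating (tournament d) d := by
  intro R hR a
  have hlt : ∀ i j, sortKey d i < sortKey d j →
      (∑ k, tournament d i k + d i).re < (∑ k, tournament d j k + d j).re := by
    intro i j hij
    simp only [tournament, Matrix.of_apply, Finset.sum_boole, Complex.add_re, Complex.natCast_re]
    refine add_lt_add_of_lt_of_le (Nat.cast_lt.2 (Finset.card_lt_card ?_)) ?_
    · refine (Finset.ssubset_iff_of_subset ?_).2 ⟨i, ?_, ?_⟩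
      · intro k hk
        simp only [Finset.mem_filter, Finset.mem_univ, true_and] at hk ⊢
        exact hk.trans hij
      · simpa using hij
      · simp
    · rcases Prod.Lex.toLex_lt_toLex.1 hij with h | h
      · exact h.le
      · exact h.1.le
  refine single_mem_of_separates R a fun b hb => ⟨_, rowSum_mem hR, fun h => ?_⟩
  rcases lt_or_gt_of_ne ((sortKey_injective d).ne hb) with h' | h'
  · exact (hlt _ _ h').ne' (congrArg Complex.re h)
  · exact (hlt _ _ h').ne (congrArg Complex.re h)

end tournament

/-! ### Degrees and separation of vertices in the threshold graph -/

section threshold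

variable {n : ℕ}

theorem thresholdGraph_diag (i : Fin (n + 1)) : thresholdGraph n i i = 0 := by
  simp [thresholdGraph]

theorem thresholdGraph_zero_one (i j : Fin (n + 1)) :
    thresholdGraph n i j = 0 ∨ thresholdGraph n i j = 1 := by
  simp only [thresholdGraph, Matrix.of_apply]
  split_ifs <;> simp

theorem thresholdGraph_symm (i j : Fin (n + 1)) : thresholdGraph n i j = thresholdGraph n j i := by
  simp only [thresholdGraph, Matrix.of_apply]
  refine if_congr ?_ rfl rfl
  rw [add_comm (j : ℕ)]
  tauto

theorem thresholdGraph_zero_succ (j : Fin n) :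
    thresholdGraph n 0 j.succ = if n / 2 < (j : ℕ) + 1 then 1 else 0 := by
  simp only [thresholdGraph, Matrix.of_apply]
  refine if_congr ?_ rfl rfl
  simp [Fin.ext_iff]

theorem thresholdGraph_succ_succ (i j : Fin n) :
    thresholdGraph n i.succ j.succ = if i ≠ j ∧ n < (i : ℕ) + j + 2 then 1 else 0 := by
  simp only [thresholdGraph, Matrix.of_apply]
  refine if_congr ?_ rfl rfl
  simp [Fin.ext_iff]
  omega

theorem sum_thresholdGraph_zero : ∑ j, thresholdGraph n 0 j = ((n - n / 2 : ℕ) : ℂ) := by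
  rw [Fin.sum_univ_succ, thresholdGraph_diag, zero_add]
  simp only [thresholdGraph_zero_succ]
  rw [Fin.sum_univ_eq_sum_range (fun j => if n / 2 < j + 1 then (1 : ℂ) else 0), Finset.sum_boole]
  have : Finset.filter (fun j => n / 2 < j + 1) (Finset.range n) = Finset.Ico (n / 2) n := by
    ext j; simp; omega
  rw [this, Nat.card_Ico]

/-- Let v = i + 1. Exactly v vertices w ≥ 1 satisfy v + w > n. The vertex v is itself among them,
and has to be dropped, precisely when v > ⌊n/2⌋, which is when 0 is a neighbour and makes up for the
loss. -/
theorem sum_thresholdGraph_succ (i : Fin n) :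
    ∑ j, thresholdGraph n i.succ j = ((i + 1 : ℕ) : ℂ) := by
  rw [Fin.sum_univ_succ, thresholdGraph_symm, thresholdGraph_zero_succ]
  simp only [thresholdGraph_succ_succ, Fin.ext_iff, ne_eq]
  rw [Fin.sum_univ_eq_sum_range
    (fun j => if ¬ (i : ℕ) = j ∧ n < (i : ℕ) + j + 2 then (1 : ℂ) else 0), Finset.sum_boole]
  have hi := i.isLt
  -- The index j stands for the vertex j + 1, so the condition on the sum reads j ≥ n - 1 - i.
  have : Finset.filter (fun j => ¬ (i : ℕ) = j ∧ n < (i : ℕ) + j + 2) (Finset.range n) =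
      (Finset.Ico (n - 1 - i) n).erase i := by
    ext j; simp; omega
  rw [this]
  split_ifs with h
  · rw [Finset.card_erase_of_mem (by simp; omega), Nat.card_Ico, ← Nat.cast_one, ← Nat.cast_add]
    congr 1
    omega
  · rw [Finset.erase_eq_of_notMem (by simp; omega), Nat.card_Ico, zero_add]
    congr 1
    omega

/-- Let M be the vector of row sums: M₀ = ⌈n/2⌉ and M_v = v + d_v for v ≥ 1. Monotonicity separates
the vertices v ≥ 1 from each other, and d_v > 0 separates 0 from every v ≥ ⌈n/2⌉. -/
theorem thresholdGraph_separating {d : Fin n → ℝ} (hd : Monotone d) (hpos : ∀ i, 0 < d i) :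
    Separating (thresholdGraph n) (Fin.cons 0 fun i => (d i : ℂ)) := by
  intro R hR
  set M : Fin (n + 1) → ℂ := fun a => ∑ j, thresholdGraph n a j +
    (Fin.cons 0 fun i => (d i : ℂ) : Fin (n + 1) → ℂ) a with hM
  have hMR : M ∈ R := rowSum_mem hR
  have hM0 : M 0 = (((n - n / 2 : ℕ) : ℝ) : ℂ) := by
    simp only [hM, sum_thresholdGraph_zero, Fin.cons_zero, add_zero, Complex.ofReal_natCast]
  have hMs : ∀ i : Fin n, M i.succ = (((i + 1 : ℕ) + d i : ℝ) : ℂ) := fun i => by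
    simp only [hM, sum_thresholdGraph_succ, Fin.cons_succ, Complex.ofReal_add,
      Complex.ofReal_natCast]
  have hss : ∀ i j : Fin n, i < j → M i.succ ≠ M j.succ := fun i j hij => by
    rw [hMs, hMs, ne_eq, Complex.ofReal_inj]
    have h1 := hd hij.le
    have h2 : ((i + 1 : ℕ) : ℝ) < ((j + 1 : ℕ) : ℝ) := Nat.cast_lt.2 (by simpa using hij)
    exact (add_lt_add_of_lt_of_le h2 h1).ne
  have hss' : ∀ i j : Fin n, i ≠ j → M i.succ ≠ M j.succ := fun i j hij => by
    rcases lt_or_gt_of_ne hij with h | h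
    · exact hss i j h
    · exact (hss j i h).symm
  have h0s : ∀ i : Fin n, n - n / 2 ≤ i + 1 → M 0 ≠ M i.succ := fun i hi => by
    rw [hM0, hMs, ne_eq, Complex.ofReal_inj]
    have h1 : ((n - n / 2 : ℕ) : ℝ) ≤ ((i + 1 : ℕ) : ℝ) := Nat.cast_le.2 hi
    exact (lt_of_le_of_lt h1 (lt_add_of_pos_right _ (hpos i))).ne
  have hsep : ∀ i : Fin n, ∃ r ∈ R, r 0 ≠ r i.succ := fun i => by
    by_cases hi : n - n / 2 ≤ i + 1
    · exact ⟨M, hMR, h0s i hi⟩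
    -- The vertex ⌊n/2⌋ + 1 is the first neighbour of 0. It is at least ⌈n/2⌉, so M separates it
    -- from all other vertices and its point mass lies in R.
    · let j : Fin n := ⟨n / 2, by omega⟩
      have hj : Pi.single j.succ 1 ∈ R := by
        refine single_mem_of_separates R _ fun b hb => ⟨M, hMR, ?_⟩
        induction b using Fin.cases with
        | zero => exact (h0s j (by simp only [j]; omega)).symm
        | succ k => exact hss' j k fun h => hb (h ▸ rfl)
      refine ⟨_, hR _ hj, ?_⟩
      have hij : i ≠ j := fun h => by
        have := congrArg Fin.val h
        simp only [j] at this
        omega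
      have hval : ∀ a, a ≠ j.succ → weightedMulVec (thresholdGraph n)
          (Fin.cons 0 fun i => (d i : ℂ)) (Pi.single j.succ 1) a =
          thresholdGraph n a j.succ := fun a ha => by
        simp [weightedMulVec, Pi.single_apply, ha]
      -- The image of that point mass is 1 at vertex 0, and 0 at a vertex v < ⌈n/2⌉, because v +
      -- ⌊n/2⌋ + 1 ≤ n.
      rw [hval _ (Fin.succ_ne_zero j).symm, hval _ fun h => hij (Fin.succ_injective _ h),
        thresholdGraph_zero_succ, thresholdGraph_succ_succ, if_pos (by simp only [j]; omega),
        if_neg]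
      · exact one_ne_zero
      · simp only [j]; omega
  intro a
  refine single_mem_of_separates R a fun b hb => ?_
  induction a using Fin.cases with
  | zero =>
    induction b using Fin.cases with
    | zero => exact absurd rfl hb
    | succ k => exact hsep k
  | succ i =>
    induction b using Fin.cases with
    | zero =>
      obtain ⟨r, hr, h⟩ := hsep i
      exact ⟨r, hr, h.symm⟩
    | succ k => exact ⟨M, hMR, hss' i k fun h => hb (h ▸ rfl)⟩

/-- The vertex n is the hub that will identify all corners of a coaction. -/
theorem thresholdGraph_last (a : Fin (n + 1)) (ha : a ≠ Fin.last n) :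
    thresholdGraph n a (Fin.last n) = 1 := by
  simp only [thresholdGraph, Matrix.of_apply]
  rw [if_pos]
  refine ⟨ha, ?_⟩
  have h1 : (a : ℕ) ≠ n := fun h => ha (Fin.ext h)
  have h2 := a.isLt
  by_cases h : a = 0
  · left
    subst h
    refine ⟨rfl, ?_⟩
    simp only [Fin.val_zero, Fin.val_last] at h1 ⊢
    omega
  · right; right
    have h3 : (a : ℕ) ≠ 0 := fun h' => h (Fin.ext h')
    refine ⟨h, fun h' => ?_, ?_⟩
    · have := congrArg Fin.val h'
      simp only [Fin.val_zero, Fin.val_last] at this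
      omega
    · simp only [Fin.val_last]; omega

end threshold

namespace FiniteQuantumSet

variable {C : Type*} [CStarAlgebra C] [FiniteDimensional ℂ C] {X : FiniteQuantumSet C}

/-! ### Coactions on `ℓ²(𝕏) ⊗ ℂᵐ` that respect the decomposition into points of `ℂᵐ` -/

section invariants

variable {D : Type*} [Ring D] [Algebra ℂ D]

variable (X) in
/-- The embedding `ℂᵐ → C(𝕏) ⊗ ℂᵐ`, `r ↦ 1 ⊗ r`. -/
def scalars (m : ℕ) : (Fin m → ℂ) →ₐ[ℂ] (X.amplify m).L2 :=
  ((X.amplify m).toL2 : (Fin m → C) →⋆ₐ[ℂ] (X.amplify m).L2).toAlgHom.comp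
    ((Algebra.ofId ℂ C).compLeft (Fin m))

theorem coord_scalars {m : ℕ} (r : Fin m → ℂ) (a : Fin m) :
    X.coord a (X.scalars m r) = r a • 1 :=
  Algebra.algebraMap_eq_smul_one (A := C) (r a)

theorem scalars_single {m : ℕ} (a : Fin m) : X.scalars m (Pi.single a 1) = X.incl a 1 := by
  refine X.ext_coord fun b => ?_
  rw [coord_scalars, coord_incl, Pi.single_apply]
  split_ifs <;> simp

/-- Regularity enters here: η is an eigenvector of every diagonal block, so ℂⁿ⁺¹ is invariant under
A' and carries a purely classical operator. -/
theorem combined_scalars {n : ℕ} {A : Fin n → X.L2 →ₗ[ℂ] X.L2}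
    (B : Matrix (Fin (n + 1)) (Fin (n + 1)) ℂ) {d : Fin n → ℂ} (hA : ∀ i, A i 1 = d i • 1)
    (r : Fin (n + 1) → ℂ) :
    X.combined A B (X.scalars (n + 1) r) =
      X.scalars (n + 1) (weightedMulVec B (Fin.cons 0 d) r) := by
  refine X.ext_coord fun a => ?_
  rw [coord_combined, coord_scalars, coord_scalars, weightedMulVec, add_smul, Finset.sum_smul]
  congr 1
  · exact Finset.sum_congr rfl fun j _ => by rw [coord_scalars, smul_smul]
  · rw [map_smul, mul_comm, ← smul_smul]
    congr 1
    induction a using Fin.cases with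
    | zero => simp
    | succ i => exact hA i

/-- Projecting to one copy of 𝕏 is multiplication by a central projection, so a multiplicative map
that fixes this projection respects the copy. -/
theorem rTensor_incl_coord {m : ℕ} (a : Fin m) (s : (X.amplify m).L2 ⊗[ℂ] D) :
    (X.incl a).rTensor D ((X.coord a).rTensor D s) = (X.incl a 1 ⊗ₜ[ℂ] 1) * s := by
  induction s using TensorProduct.induction_on with
  | zero => simp
  | add s t hs ht => rw [map_add, map_add, mul_add, hs, ht]
  | tmul x d =>
    rw [LinearMap.rTensor_tmul, LinearMap.rTensor_tmul, Algebra.TensorProduct.tmul_mul_tmul,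
      incl_mul_left, one_mul, one_mul]

variable {n : ℕ} {A : Fin n → X.L2 →ₗ[ℂ] X.L2} {B : Matrix (Fin (n + 1)) (Fin (n + 1)) ℂ}
  {β : (X.amplify (n + 1)).L2 →ₗ[ℂ] (X.amplify (n + 1)).L2 ⊗[ℂ] D}

/-- The elements of `ℂⁿ⁺¹` that are fixed by a coaction on `C(𝕏) ⊗ ℂⁿ⁺¹`. -/
def fixedScalars (hβ : IsQutCoaction (fun _ : Unit => X.combined A B) β) :
    Subalgebra ℂ (Fin (n + 1) → ℂ) :=
  AlgHom.equalizer ((AlgHom.ofLinearMap β hβ.map_one hβ.map_mul).comp (X.scalars (n + 1)))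
    (Algebra.TensorProduct.includeLeft.comp (X.scalars (n + 1)))

theorem mem_fixedScalars (hβ : IsQutCoaction (fun _ : Unit => X.combined A B) β)
    (r : Fin (n + 1) → ℂ) : r ∈ fixedScalars hβ ↔
      β (X.scalars (n + 1) r) = X.scalars (n + 1) r ⊗ₜ[ℂ] 1 := Iff.rfl

/-- The fixed scalars form a subalgebra; since β commutes with A', it is stable under B + diag d,
and `Separating` applies. -/
theorem IsQutCoaction.map_incl_one (hβ : IsQutCoaction (fun _ : Unit => X.combined A B) β)
    {d : Fin n → ℂ} (hA : ∀ i, A i 1 = d i • 1) (hB : Separating B (Fin.cons 0 d))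
    (a : Fin (n + 1)) : β (X.incl a 1) = X.incl a 1 ⊗ₜ[ℂ] 1 := by
  rw [← scalars_single]
  refine (mem_fixedScalars hβ _).1 (hB _ (fun r hr => ?_) a)
  rw [mem_fixedScalars] at hr ⊢
  rw [← combined_scalars B hA, hβ.comm (), hr, LinearMap.rTensor_tmul]

/-- As x ⊗ eₐ = (1 ⊗ eₐ)(x ⊗ eₐ), its image is a multiple of the fixed projection and stays in the
a-th copy. -/
theorem IsQutCoaction.map_incl (hβ : IsQutCoaction (fun _ : Unit => X.combined A B) β)
    (h : ∀ a, β (X.incl a 1) = X.incl a 1 ⊗ₜ[ℂ] 1) (a : Fin (n + 1)) (x : X.L2) :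
    β (X.incl a x) = (X.incl a).rTensor D (cornerCoaction a β x) := by
  rw [cornerCoaction, LinearMap.comp_apply, rTensor_incl_coord, ← h, LinearMap.comp_apply,
    ← hβ.map_mul, ← incl_mul, one_mul]

/-- This is the (a, c) block of βA' = A'β, where β is block diagonal. -/
theorem IsQutCoaction.corner_block (hβ : IsQutCoaction (fun _ : Unit => X.combined A B) β)
    (h : ∀ a, β (X.incl a 1) = X.incl a 1 ⊗ₜ[ℂ] 1) (a c : Fin (n + 1)) (x : X.L2) :
    cornerCoaction a β (X.block (X.combined A B) a c x) =
      (X.block (X.combined A B) a c).rTensor D (cornerCoaction c β x) := by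
  have h1 := congrArg ((X.coord a).rTensor D) (hβ.comm () (X.incl c x))
  rw [hβ.map_incl h, ← X.sum_incl_coord (X.combined A B (X.incl c x)), map_sum, map_sum,
    Finset.sum_eq_single a] at h1
  · rw [hβ.map_incl h, rTensor_coord_incl, if_pos rfl] at h1
    refine Eq.trans h1 ?_
    rw [block, LinearMap.rTensor_comp_apply, LinearMap.rTensor_comp_apply]
  · intro e _ he
    rw [hβ.map_incl h, rTensor_coord_incl, if_neg he.symm]
  · simp

/-- A coaction that commutes with `A'` is an amplification, provided that `B` separates the
vertices and has a vertex adjacent to all others. -/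
theorem IsQutCoaction.of_combined (hβ : IsQutCoaction (fun _ : Unit => X.combined A B) β)
    {d : Fin n → ℂ} (hA : ∀ i, A i 1 = d i • 1) (hsep : Separating B (Fin.cons 0 d))
    (hdiag : ∀ a, B a a = 0) {c : Fin (n + 1)} (hub : ∀ a, a ≠ c → B a c = 1 ∨ B c a = 1) :
    IsQutCoaction A (cornerCoaction 0 β) ∧
      β = amplifyCoaction (n + 1) (cornerCoaction 0 β) := by
  have h := hβ.map_incl_one hA hsep
  -- Along an edge the block of A' is the identity, which intertwines the two corners only if they
  -- coincide.
  have hedge : ∀ a e, a ≠ e → B a e = 1 → cornerCoaction a β = cornerCoaction e β := by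
    intro a e hae hB
    refine LinearMap.ext fun x => ?_
    have h1 := hβ.corner_block h a e x
    rwa [block_combined, if_neg hae, hB, one_smul, add_zero, LinearMap.id_apply,
      LinearMap.rTensor_id, LinearMap.id_apply] at h1
  have hc : ∀ a, cornerCoaction a β = cornerCoaction c β := fun a => by
    by_cases hac : a = c
    · rw [hac]
    · rcases hub a hac with h1 | h1
      · exact hedge a c hac h1
      · exact (hedge c a (Ne.symm hac) h1).symm
  have h0 : ∀ a, cornerCoaction a β = cornerCoaction 0 β := fun a => (hc a).trans (hc 0).symm
  refine ⟨⟨fun x y => ?_, ?_, fun i x => ?_⟩, ?_⟩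
  · simp only [cornerCoaction, LinearMap.comp_apply]
    rw [incl_mul, hβ.map_mul, rTensor_coord_mul]
  · rw [cornerCoaction, LinearMap.comp_apply, LinearMap.comp_apply, h, LinearMap.rTensor_tmul,
      coord_incl_self, Algebra.TensorProduct.one_def]
  · have h1 := hβ.corner_block h i.succ i.succ x
    rwa [block_combined, if_pos rfl, hdiag, zero_smul, zero_add, Fin.cons_succ, h0] at h1
  · refine LinearMap.ext fun f => ?_
    conv_lhs => rw [← X.sum_incl_coord f, map_sum]
    rw [amplifyCoaction, LinearMap.sum_apply]
    refine Finset.sum_congr rfl fun a _ => ?_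
    rw [hβ.map_incl h, h0, LinearMap.comp_apply, LinearMap.comp_apply]

end invariants

/-! ### The isomorphism of quantum automorphism groups -/

namespace QutInterAlg

theorem algHom_ext_of_star {ι κ : Type*} [Fintype ι] [DecidableEq ι]
    {b : OrthonormalBasis ι ℂ X.L2} {A : κ → X.L2 →ₗ[ℂ] X.L2} {D : Type*} [Ring D] [StarRing D]
    [Algebra ℂ D] {f g : QutInterAlg b A →ₐ[ℂ] D} (hf : ∀ x, f (star x) = star (f x))
    (hg : ∀ x, g (star x) = star (g x)) (h : ∀ i j, f (u b A i j) = g (u b A i j)) : f = g :=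
  algHom_ext h fun i j => by rw [hf, hg, h]

/-- Two algebra homomorphisms that agree on the coefficients of the canonical action and preserve
stars are equal. -/
theorem algHom_ext_of_action {ι κ : Type*} [Fintype ι] [DecidableEq ι]
    {b : OrthonormalBasis ι ℂ X.L2} {A : κ → X.L2 →ₗ[ℂ] X.L2} {D : Type*} [Ring D] [StarRing D]
    [Algebra ℂ D] {f g : QutInterAlg b A →ₐ[ℂ] D} (hf : ∀ x, f (star x) = star (f x))
    (hg : ∀ x, g (star x) = star (g x))
    (h : f.toLinearMap.lTensor _ ∘ₗ action b A = g.toLinearMap.lTensor _ ∘ₗ action b A) :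
    f = g := by
  refine algHom_ext_of_star hf hg fun i j => ?_
  have h1 := congrArg (fun T => slice (b i) (T (b j))) h
  simp only [LinearMap.comp_apply, slice_lTensor] at h1
  have h2 : slice (b i) (action b A (b j)) = u b A i j := slice_coactionMap b (u b A) i j
  rwa [h2] at h1

theorem lTensor_lift_action {ι κ : Type*} [Fintype ι] [DecidableEq ι]
    {b : OrthonormalBasis ι ℂ X.L2} {A : κ → X.L2 →ₗ[ℂ] X.L2} {D : Type*} [Ring D] [StarRing D]
    [Algebra ℂ D] [StarModule ℂ D] {α : X.L2 →ₗ[ℂ] X.L2 ⊗[ℂ] D}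
    (h : IsQutMatrix b A fun i j => coeffMatrix b α i j) :
    (lift _ h).toLinearMap.lTensor _ ∘ₗ action b A = α := by
  refine (lTensor_coactionMap b (u b A) _).trans ?_
  conv_rhs => rw [← coactionMap_coeffMatrix b α]
  congr 1
  funext i j
  exact lift_u _ h i j

end QutInterAlg

-- Both homomorphisms come from universal properties: Φ from the amplification of the action on 𝕏,
-- its inverse Ψ from the 0-th corner of the action on 𝕏 ⊗ ℂⁿ⁺¹.
open QutInterAlg in
theorem qutEqInter_combined {n : ℕ} {A : Fin n → X.L2 →ₗ[ℂ] X.L2}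
    {B : Matrix (Fin (n + 1)) (Fin (n + 1)) ℂ} {d : Fin n → ℂ} (hA : ∀ i, A i 1 = d i • 1)
    (hsep : Separating B (Fin.cons 0 d)) (hdiag : ∀ a, B a a = 0) {c : Fin (n + 1)}
    (hub : ∀ a, a ≠ c → B a c = 1 ∨ B c a = 1) {ι ι' : Type*} [Fintype ι] [DecidableEq ι]
    [Fintype ι'] [DecidableEq ι'] (b : OrthonormalBasis ι ℂ X.L2)
    (b' : OrthonormalBasis ι' ℂ (X.amplify (n + 1)).L2) :
    QutEqInter b A b' (X.combined A B) := by
  set A' : Unit → (X.amplify (n + 1)).L2 →ₗ[ℂ] (X.amplify (n + 1)).L2 :=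
    fun _ => X.combined A B with hA'
  have hα := isQutMatrix_iff.1 (isQutMatrix_u (b := b) (A := A))
  have hβ := isQutMatrix_iff.1 (isQutMatrix_u (b := b') (A := A'))
  have hcα : coeffMatrix b (action b A) = Matrix.of (u b A) := by
    ext i j; exact slice_coactionMap b (u b A) i j
  have hcβ : coeffMatrix b' (action b' A') = Matrix.of (u b' A') := by
    ext i j; exact slice_coactionMap b' (u b' A') i j
  obtain ⟨hγ, hβγ⟩ := hβ.1.of_combined hA hsep hdiag hub
  change action b' A' = amplifyCoaction (n + 1) (cornerCoaction 0 (action b' A')) at hβγ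
  have hΦ : IsQutMatrix b' A' fun i j =>
      coeffMatrix b' (amplifyCoaction (n + 1) (action b A)) i j := by
    refine isQutMatrix_coeffMatrix_iff.2 ⟨IsQutCoaction.amplify hα.1 B, ?_⟩
    rw [coeffMatrix_amplifyCoaction b, amplifyMatrix_mem_unitary_iff b b' 0, hcα]
    exact hα.2
  have hΨ : IsQutMatrix b A fun i j =>
      coeffMatrix b (cornerCoaction 0 (action b' A')) i j := by
    refine isQutMatrix_coeffMatrix_iff.2 ⟨hγ, ?_⟩
    rw [← amplifyMatrix_mem_unitary_iff b b' 0, ← coeffMatrix_amplifyCoaction b, ← hβγ, hcβ]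
    exact hβ.2
  let Φ : QutInterAlg b' A' →ₐ[ℂ] QutInterAlg b A := lift _ hΦ
  let Ψ : QutInterAlg b A →ₐ[ℂ] QutInterAlg b' A' := lift _ hΨ
  have hΦs : ∀ x, Φ (star x) = star (Φ x) := lift_star _ hΦ
  have hΨs : ∀ x, Ψ (star x) = star (Ψ x) := lift_star _ hΨ
  have hΦa : Φ.toLinearMap.lTensor _ ∘ₗ action b' A' = amplifyCoaction (n + 1) (action b A) :=
    lTensor_lift_action hΦ
  have hΨa : Ψ.toLinearMap.lTensor _ ∘ₗ action b A = cornerCoaction 0 (action b' A') :=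
    lTensor_lift_action hΨ
  have hΦΨ : Φ.comp Ψ = AlgHom.id ℂ _ := by
    refine algHom_ext_of_action (fun x => ?_) (fun x => rfl) ?_
    · rw [AlgHom.comp_apply, AlgHom.comp_apply, hΨs, hΦs]
    · rw [AlgHom.comp_toLinearMap, LinearMap.lTensor_comp, LinearMap.comp_assoc, hΨa,
        lTensor_cornerCoaction, hΦa, cornerCoaction_amplifyCoaction, AlgHom.toLinearMap_id,
        LinearMap.lTensor_id, LinearMap.id_comp]
  -- Unlike the other composite, this one needs the structure result `hβγ`: the universal action for
  -- A' is the amplification of its own corner.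
  have hΨΦ : Ψ.comp Φ = AlgHom.id ℂ _ := by
    refine algHom_ext_of_action (fun x => ?_) (fun x => rfl) ?_
    · rw [AlgHom.comp_apply, AlgHom.comp_apply, hΦs, hΨs]
    · rw [AlgHom.comp_toLinearMap, LinearMap.lTensor_comp, LinearMap.comp_assoc, hΦa,
        lTensor_amplifyCoaction, hΨa, ← hβγ, AlgHom.toLinearMap_id,
        LinearMap.lTensor_id, LinearMap.id_comp]
  have hΦu : ∀ I J, Φ (u b' A' I J) = amplifyMatrix b b' (Matrix.of (u b A)) I J := fun I J => by
    rw [← hcα, ← coeffMatrix_amplifyCoaction b]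
    exact lift_u _ hΦ I J
  have hcounit : (Bialgebra.counitAlgHom ℂ (QutInterAlg b A)).comp Φ =
      Bialgebra.counitAlgHom ℂ (QutInterAlg b' A') := by
    change (counitHom b A).comp Φ = counitHom b' A'
    refine algHom_ext_of_star (fun x => ?_) (fun x => lift_star _ _ x) fun I J => ?_
    · rw [AlgHom.comp_apply, AlgHom.comp_apply, hΦs]
      exact lift_star _ _ _
    · rw [AlgHom.comp_apply, hΦu, counitHom_u]
      have h1 : (Matrix.of (u b A)).map (counitHom b A) = 1 := by
        ext i j
        rw [Matrix.map_apply, Matrix.of_apply, counitHom_u, Matrix.one_apply]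
      have h2 := congrFun₂ (amplifyMatrix_map b b' (counitHom b A) (Matrix.of (u b A))) I J
      rwa [h1, amplifyMatrix_one, Matrix.map_apply, Matrix.one_apply] at h2
  have hcomul : (Algebra.TensorProduct.map Φ Φ).comp
      (Bialgebra.comulAlgHom ℂ (QutInterAlg b' A')) =
      (Bialgebra.comulAlgHom ℂ (QutInterAlg b A)).comp Φ := by
    change (Algebra.TensorProduct.map Φ Φ).comp (comulHom b' A') = (comulHom b A).comp Φ
    have hmap : ∀ t, Algebra.TensorProduct.map Φ Φ (star t) =
        star (Algebra.TensorProduct.map Φ Φ t) := fun t => by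
      induction t using TensorProduct.induction_on with
      | zero => simp
      | add s t hs ht => rw [star_add, map_add, map_add, star_add, hs, ht]
      | tmul x y =>
        rw [TensorProduct.star_tmul, Algebra.TensorProduct.map_tmul,
          Algebra.TensorProduct.map_tmul, TensorProduct.star_tmul, hΦs, hΦs]
    refine algHom_ext_of_star (fun x => ?_) (fun x => ?_) fun I J => ?_
    · rw [AlgHom.comp_apply, AlgHom.comp_apply, comulHom_star, hmap]
    · rw [AlgHom.comp_apply, AlgHom.comp_apply, hΦs, comulHom_star]
    · let l : QutInterAlg b A →ₐ[ℂ] QutInterAlg b A ⊗[ℂ] QutInterAlg b A :=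
        Algebra.TensorProduct.includeLeft
      let r : QutInterAlg b A →ₐ[ℂ] QutInterAlg b A ⊗[ℂ] QutInterAlg b A :=
        Algebra.TensorProduct.includeRight
      -- In matrix form Δ(u) = (u ⊗ 1)(1 ⊗ u), a product that amplification respects.
      have h1 : (Matrix.of (u b A)).map (comulHom b A) =
          (Matrix.of (u b A)).map l * (Matrix.of (u b A)).map r := by
        ext i j
        rw [Matrix.map_apply, Matrix.of_apply, comulHom_u, Matrix.mul_apply]
        refine Finset.sum_congr rfl fun k _ => ?_
        simp [l, r]
      have h2 := congrFun₂ (amplifyMatrix_map b b' (comulHom b A) (Matrix.of (u b A))) I J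
      rw [h1, amplifyMatrix_mul, ← amplifyMatrix_map, ← amplifyMatrix_map, Matrix.map_apply,
        Matrix.mul_apply] at h2
      rw [AlgHom.comp_apply, AlgHom.comp_apply, hΦu, h2, comulHom_u, map_sum]
      refine Finset.sum_congr rfl fun K _ => ?_
      rw [Algebra.TensorProduct.map_tmul, hΦu, hΦu]
      simp [l, r]
  refine ⟨BialgEquiv.ofAlgEquiv (AlgEquiv.ofAlgHom Φ Ψ hΦΨ hΨΦ) hcounit hcomul, hΦs,
    fun a => ?_⟩
  refine LinearMap.ext fun f => ?_
  have h1 := congrArg ((X.coord a).rTensor _) (LinearMap.congr_fun hΦa f)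
  rw [rTensor_coord_amplifyCoaction, LinearMap.comp_apply, ← LinearMap.comp_apply,
    LinearMap.rTensor_comp_lTensor] at h1
  exact h1

theorem combinesTo_of_separating {n : ℕ} {A : Fin n → X.L2 →ₗ[ℂ] X.L2}
    {B : Matrix (Fin (n + 1)) (Fin (n + 1)) ℂ} {d : Fin n → ℂ}
    (hA : ∀ i, X.IsQuantumGraph (A i)) (hloop : ∀ i, X.NoLoops (A i))
    (hreg : ∀ i, X.IsRegularOfDegree (A i) (d i)) (hB : ∀ i j, B i j = 0 ∨ B i j = 1)
    (hdiag : ∀ a, B a a = 0) (hsep : Separating B (Fin.cons 0 d)) {c : Fin (n + 1)}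
    (hub : ∀ a, a ≠ c → B a c = 1 ∨ B c a = 1) : X.CombinesTo A B where
  isQuantumGraph := X.isQuantumGraph_combined hA hB hdiag
  noLoops := X.noLoops_combined hloop hdiag
  qut_eq _ _ b b' := qutEqInter_combined (fun i => (hreg i).apply_one) hsep hdiag hub b b'

end FiniteQuantumSet

end

theorem theorem5p2 {C : Type*} [CStarAlgebra C] [FiniteDimensional ℂ C] (X : FiniteQuantumSet C)
    (n : ℕ) (A : Fin n → X.L2 →ₗ[ℂ] X.L2)
    (hA : ∀ i, X.IsQuantumGraph (A i))
    (hloop : ∀ i, X.NoLoops (A i))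
    (hreg : ∀ i, X.IsRegular (A i)) :
    (∃ B : Matrix (Fin (n + 1)) (Fin (n + 1)) ℂ,
      (∀ i j, B i j = 0 ∨ B i j = 1) ∧ (∀ i, B i i = 0) ∧ X.CombinesTo A B) ∧
    (∀ d : Fin n → ℝ, (∀ i, X.IsRegularOfDegree (A i) (d i : ℂ)) → Monotone d →
      (∀ i, A i ≠ 0) → X.CombinesTo A (thresholdGraph n)) := by
  constructor
  · choose d hd using hreg
    set e : Fin (n + 1) → ℂ := Fin.cons 0 d
    have h01 : ∀ i j, tournament e i j = 0 ∨ tournament e i j = 1 := fun i j => by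
      simp only [tournament, Matrix.of_apply]
      split_ifs <;> simp
    have hdiag : ∀ i, tournament e i i = 0 := fun i => by simp [tournament]
    refine ⟨tournament e, h01, hdiag, FiniteQuantumSet.combinesTo_of_separating hA hloop hd h01
      -- Any vertex may serve as hub, since in a tournament every two vertices are joined in one
      -- direction.
      hdiag (tournament_separating e) (c := 0) fun a ha => ?_⟩
    rcases lt_or_gt_of_ne ((sortKey_injective e).ne ha) with h | h
    · exact Or.inr (if_pos h)
    · exact Or.inl (if_pos h)
  · intro d hd hmono h0
    exact FiniteQuantumSet.combinesTo_of_separating hA hloop hd thresholdGraph_zero_one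
      thresholdGraph_diag (thresholdGraph_separating hmono fun i => (hd i).pos (hA i) (h0 i))
      (c := Fin.last n) fun a ha => Or.inl (thresholdGraph_last a ha)
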